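/- Let $X$ be a locally compact Hausdorff space, $B$ a C$^*$-algebra, and let $A=C_0(X,B)$ be the trivial $C_0(X)$-algebra, on which $C_0(X)$ acts by pointwise multiplication. Conventions. A $C_0(X)$-algebra is a C$^*$-algebra $A$ with a $*$-homomorphism $\mu: C_0(X)\to ZM(A)$ such that $\mu(C_0(X))A=A$. Put $J_x=\overline{\mathrm{span}}\{\mu(f)a : f(x)=0\}$, $A_x=A/J_x$, $a(x)=a+J_x$ and $X_A=\{x: A_x\neq 0\}$. A cross-section $b:Y\to\coprod_{x\in Y}A_x$, $Y\subseteq X$, is continuous if for all $x\in Y$ and $\varepsilon>0$ there are a neighbourhood $U$ of $x$ in $Y$ and $a\in A$ with $\|b(y)-a(y)\|<\varepsilon$ for all $y\in U$; $\Gamma^b(A)$ is the $*$-algebra of bounded continuous cross-sections over $X_A$, with the supremum norm. The structure map extends to $\mu_{M(A)}:C(\beta X)\to ZM(A)$; let $H_y=\overline{\mathrm{span}}\{\mu_{M(A)}(f)m : f(y)=0,\ m\in M(A)\}$ for $y\in\beta X$, and $A^\beta=\bigcap_{x\in X_A}(A+H_x)\subseteq M(A)$. This is a C$^*$-algebra,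 and a $C(\beta X)$-algebra for the multiplication by $\mu_{M(A)}(f)$, $f\in C(\beta X)$. A $C_0(X)$-algebra is continuous if $x\mapsto\|a(x)\|$ is continuous for every $a\in A$. Claim. (i) For every $x \in X$, evaluation at $x$ induces a $*$-isomorphism $A_x\cong B$. Under these identifications $\Gamma^b(A)=C^b(X,B)$, as $*$-algebras and isometrically. Likewise, $A^\beta=C^b(X,B)$, where $a\in C^b(X,B)$ is regarded as the multiplier $F\mapsto aF$ of $A$. (ii) $A^\beta$ is a continuous $C(\beta X)$-algebra. For each $x\in X$ the inclusion $A\subseteq A^\beta$ induces a $*$-isomorphism $B\cong A_x\cong A^\beta_x$. Under these identifications every $a\in C^b(X,B)$ extends uniquely to a continuous cross-section $\overline a:\beta X\to\coprod_{y\in\beta X}A^\beta_y$. Moreover, the following are equivalent: (iii) $A^\beta$ is canonically isomorphic to $C(\beta X,B)$, i.e. sending $g\in C(\beta X,B)$ to the multiplier $F\mapsto (g|_X)F$ of $A$ defines a $*$-isomorphism $C(\beta X,B)\to A^\beta$; (iv) $B$ is finite-dimensional or $X$ is pseudocompact (every continuous function $X\to\mathbb C$ is bounded). -/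

import Mathlib

open scoped ZeroAtInfty MultiplierAlgebra BoundedContinuousFunction Topology
open Filter

universe u v

noncomputable section

/-! ### Elementary facts on multipliers of a C*-algebra -/

namespace MultiplierAux

variable {A : Type v} [NonUnitalCStarAlgebra A]

theorem eq_of_forall_mul_left {a b : A} (h : ∀ c : A, c * a = c * b) : a = b := by
  have h1 : star (a - b) * (a - b) = 0 := by rw [mul_sub, h, sub_self]
  exact sub_eq_zero.mp ((CStarRing.star_mul_self_eq_zero_iff _).mp h1)

theorem eq_of_forall_mul_right {a b : A} (h : ∀ c : A, a * c = b * c) : a = b := by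
  have h1 : (a - b) * star (a - b) = 0 := by rw [sub_mul, h, sub_self]
  exact sub_eq_zero.mp ((CStarRing.mul_star_self_eq_zero_iff _).mp h1)

theorem fst_mul (z : 𝓜(ℂ, A)) (a b : A) : z.fst (a * b) = z.fst a * b := by
  refine eq_of_forall_mul_left fun c => ?_
  rw [← z.central, ← mul_assoc, z.central, mul_assoc]

theorem snd_mul (z : 𝓜(ℂ, A)) (a b : A) : z.snd (a * b) = a * z.snd b := by
  refine eq_of_forall_mul_right fun c => ?_
  rw [z.central, mul_assoc, mul_assoc, z.central]

theorem mul_coe (z : 𝓜(ℂ, A)) (a : A) : z * (a : 𝓜(ℂ, A)) = (z.fst a : A) := by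
  refine DoubleCentralizer.ext _ _ _ _ (Prod.ext ?_ ?_)
  · ext b
    simp [fst_mul]
  · ext b
    simp [z.central]

theorem coe_mul (z : 𝓜(ℂ, A)) (a : A) : (a : 𝓜(ℂ, A)) * z = (z.snd a : A) := by
  refine DoubleCentralizer.ext _ _ _ _ (Prod.ext ?_ ?_)
  · ext b
    simp [z.central]
  · ext b
    simp [snd_mul]

theorem coe_injective : Function.Injective (fun a : A => (a : 𝓜(ℂ, A))) := by
  intro a b h
  refine eq_of_forall_mul_right fun c => ?_
  have := congrArg (fun z : 𝓜(ℂ, A) => z.fst c) h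
  simpa using this

theorem fst_eq_snd_of_central {z : 𝓜(ℂ, A)} (h : ∀ m, z * m = m * z) (a : A) :
    z.fst a = z.snd a := by
  apply coe_injective
  change ((z.fst a : A) : 𝓜(ℂ, A)) = (z.snd a : A)
  rw [← mul_coe, ← coe_mul, h]

theorem ext_fst {z w : 𝓜(ℂ, A)} (h : ∀ a, z.fst a = w.fst a) : z = w := by
  have h1 : z.fst = w.fst := ContinuousLinearMap.ext h
  refine DoubleCentralizer.ext _ _ _ _ (Prod.ext h1 ?_)
  ext b
  refine eq_of_forall_mul_right fun c => ?_
  rw [z.central, w.central, h]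

theorem central_of_fst_eq_snd {z : 𝓜(ℂ, A)} (h : ∀ a, z.fst a = z.snd a) (m : 𝓜(ℂ, A)) :
    z * m = m * z := by
  refine ext_fst fun a => eq_of_forall_mul_left fun b => ?_
  change b * z.fst (m.fst a) = b * m.fst (z.fst a)
  rw [← m.central, ← z.central, ← h, ← fst_mul, ← m.central, h, snd_mul, ← h]

end MultiplierAux

/-! ### `C₀(X)`-algebras, their fibres and their continuous sections -/

/-- A `C₀(X)`-algebra structure on the C*-algebra `A`: a `*`-homomorphism from `C₀(X)` to the
centre of the multiplier algebra of `A` such that `μ(C₀(X)) A = A`. -/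
structure CZeroAlgebra (X : Type u) (A : Type v) [TopologicalSpace X] [T2Space X]
    [LocallyCompactSpace X] [NonUnitalCStarAlgebra A] where
  μ : C₀(X, ℂ) →⋆ₙₐ[ℂ] 𝓜(ℂ, A)
  central : ∀ (f : C₀(X, ℂ)) (m : 𝓜(ℂ, A)), μ f * m = m * μ f
  nondegenerate : ∀ a : A, ∃ (f : C₀(X, ℂ)) (b : A), (μ f).fst b = a

namespace CZeroAlgebra

variable {X : Type u} {A : Type v} [TopologicalSpace X] [T2Space X] [LocallyCompactSpace X]
  [NonUnitalCStarAlgebra A] (T : CZeroAlgebra X A)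

theorem μ_fst_eq_snd (f : C₀(X, ℂ)) (a : A) : (T.μ f).fst a = (T.μ f).snd a :=
  MultiplierAux.fst_eq_snd_of_central (T.central f) a

theorem μ_mul (f g : C₀(X, ℂ)) (a : A) : (T.μ (f * g)).fst a = (T.μ f).fst ((T.μ g).fst a) := by
  rw [map_mul]; rfl

theorem mul_μ (f : C₀(X, ℂ)) (a b : A) : a * (T.μ f).fst b = (T.μ f).fst (a * b) := by
  rw [← (T.μ f).central, ← μ_fst_eq_snd, MultiplierAux.fst_mul]

theorem star_μ (f : C₀(X, ℂ)) (a : A) : star ((T.μ f).fst a) = (T.μ (star f)).fst (star a) := by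
  rw [μ_fst_eq_snd, map_star (T.μ) f, DoubleCentralizer.star_fst, star_star]

/-- The closed ideal `J_x` of `A`: the closed linear span of the elements `μ(f) a` where `f`
vanishes at `x`. -/
def J (x : X) : Submodule ℂ A :=
  (Submodule.span ℂ {c : A | ∃ (f : C₀(X, ℂ)) (a : A), f x = 0 ∧ c = (T.μ f).fst a}).topologicalClosure

theorem isClosed_J (x : X) : IsClosed (T.J x : Set A) :=
  Submodule.isClosed_topologicalClosure _

theorem J_induction (x : X) {p : A → Prop} (hp : IsClosed {a | p a})
    (h1 : ∀ (f : C₀(X, ℂ)) (a : A), f x = 0 → p ((T.μ f).fst a)) (h0 : p 0)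
    (hadd : ∀ a b, p a → p b → p (a + b)) (hsmul : ∀ (c : ℂ) a, p a → p (c • a))
    {a : A} (ha : a ∈ T.J x) : p a := by
  have hle : (Submodule.span ℂ
      {c : A | ∃ (f : C₀(X, ℂ)) (a : A), f x = 0 ∧ c = (T.μ f).fst a} : Set A) ⊆ {a | p a} := by
    intro b hb
    induction hb using Submodule.span_induction with
    | mem y hy => obtain ⟨f, a, hf, rfl⟩ := hy; exact h1 f a hf
    | zero => exact h0
    | add y z _ _ hy hz => exact hadd y z hy hz
    | smul c y _ hy => exact hsmul c y hy
  exact closure_minimal hle hp ha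

theorem μ_mem_J {x : X} {f : C₀(X, ℂ)} (hf : f x = 0) (a : A) : (T.μ f).fst a ∈ T.J x :=
  Submodule.le_topologicalClosure _ (Submodule.subset_span ⟨f, a, hf, rfl⟩)

theorem mul_mem_J_left {x : X} (b : A) {a : A} (ha : a ∈ T.J x) : b * a ∈ T.J x := by
  refine T.J_induction x (p := fun a => b * a ∈ T.J x) ?_ ?_ ?_ ?_ ?_ ha
  · exact (T.isClosed_J x).preimage (continuous_const.mul continuous_id)
  · intro f a hf
    rw [mul_μ]
    exact T.μ_mem_J hf _
  · simp
  · intro a c h1 h2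
    rw [mul_add]
    exact add_mem h1 h2
  · intro c a h
    rw [mul_smul_comm]
    exact Submodule.smul_mem _ _ h

theorem star_mem_J {x : X} {a : A} (ha : a ∈ T.J x) : star a ∈ T.J x := by
  refine T.J_induction x (p := fun a => star a ∈ T.J x) ?_ ?_ ?_ ?_ ?_ ha
  · exact (T.isClosed_J x).preimage continuous_star
  · intro f a hf
    rw [star_μ]
    exact T.μ_mem_J (by simp [hf]) _
  · simp
  · intro a c h1 h2
    rw [star_add]
    exact add_mem h1 h2
  · intro c a h
    rw [star_smul]
    exact Submodule.smul_mem _ _ h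

theorem mul_mem_J_right {x : X} (b : A) {a : A} (ha : a ∈ T.J x) : a * b ∈ T.J x := by
  have := T.star_mem_J (T.mul_mem_J_left (star b) (T.star_mem_J ha))
  simpa using this

/-- The fibre `A_x = A / J_x`, with the quotient norm. -/
def Fibre (x : X) : Type v := A ⧸ T.J x

namespace Fibre

variable (x : X)

instance instNormedAddCommGroup : NormedAddCommGroup (T.Fibre x) :=
  Submodule.Quotient.normedAddCommGroup (T.J x) (hS := T.isClosed_J x)

instance instNormedSpace : NormedSpace ℂ (T.Fibre x) :=
  Submodule.Quotient.normedSpace (T.J x) ℂ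

/-- The quotient map `A → A_x`, as a linear map. -/
def mk : A →ₗ[ℂ] T.Fibre x := (T.J x).mkQ

theorem mk_surjective : Function.Surjective (mk T x) := Submodule.mkQ_surjective _

theorem mk_eq_mk {a b : A} : mk T x a = mk T x b ↔ a - b ∈ T.J x :=
  Submodule.Quotient.eq (T.J x)

theorem norm_mk_le (a : A) : ‖mk T x a‖ ≤ ‖a‖ := Submodule.Quotient.norm_mk_le (T.J x) a

theorem norm_mk_lt (y : T.Fibre x) {ε : ℝ} (hε : 0 < ε) :
    ∃ a : A, mk T x a = y ∧ ‖a‖ < ‖y‖ + ε :=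
  Submodule.Quotient.norm_mk_lt (S := T.J x) y hε

instance instMul : Mul (T.Fibre x) where
  mul y z := Quotient.map₂ (sa := (T.J x).quotientRel) (sb := (T.J x).quotientRel)
    (sc := (T.J x).quotientRel) (fun a b : A => a * b) (by
      intro a a' h b b' h'
      replace h := (Submodule.quotientRel_def (T.J x)).mp h
      replace h' := (Submodule.quotientRel_def (T.J x)).mp h'
      refine (Submodule.quotientRel_def (T.J x)).mpr ?_
      have : a * b - a' * b' = (a - a') * b + a' * (b - b') := by noncomm_ring
      rw [this]
      exact add_mem (T.mul_mem_J_right b h) (T.mul_mem_J_left a' h')) y z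

instance instStar : Star (T.Fibre x) where
  star y := Quotient.map (sa := (T.J x).quotientRel) (sb := (T.J x).quotientRel)
    (fun a : A => star a) (by
      intro a a' h
      replace h := (Submodule.quotientRel_def (T.J x)).mp h
      refine (Submodule.quotientRel_def (T.J x)).mpr ?_
      rw [← star_sub]
      exact T.star_mem_J h) y

theorem mk_mul (a b : A) : mk T x (a * b) = mk T x a * mk T x b := rfl

theorem mk_star (a : A) : mk T x (star a) = star (mk T x a) := rfl

theorem forall_mk {p : T.Fibre x → Prop} : (∀ y, p y) ↔ ∀ a, p (mk T x a) :=
  (mk_surjective T x).forall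

theorem norm_mul_le_aux (y z : T.Fibre x) : ‖y * z‖ ≤ ‖y‖ * ‖z‖ := by
  have key : ∀ ε : ℝ, 0 < ε → ‖y * z‖ ≤ (‖y‖ + ε) * (‖z‖ + ε) := by
    intro ε hε
    obtain ⟨a, rfl, ha⟩ := norm_mk_lt T x y hε
    obtain ⟨b, rfl, hb⟩ := norm_mk_lt T x z hε
    rw [← mk_mul]
    refine (norm_mk_le T x _).trans ((norm_mul_le a b).trans ?_)
    exact mul_le_mul ha.le hb.le (norm_nonneg _) (by positivity)
  have hlim : Tendsto (fun ε : ℝ => (‖y‖ + ε) * (‖z‖ + ε)) (𝓝[>] 0) (𝓝 (‖y‖ * ‖z‖)) := by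
    have : ContinuousAt (fun ε : ℝ => (‖y‖ + ε) * (‖z‖ + ε)) 0 := by fun_prop
    simpa using! this.tendsto.mono_left nhdsWithin_le_nhds
  exact ge_of_tendsto hlim (eventually_mem_nhdsWithin.mono fun ε hε => key ε hε)

theorem norm_star_aux (y : T.Fibre x) : ‖star y‖ ≤ ‖y‖ := by
  refine le_of_forall_pos_le_add fun ε hε => ?_
  obtain ⟨a, rfl, ha⟩ := norm_mk_lt T x y hε
  rw [← mk_star]
  exact (norm_mk_le T x _).trans ((norm_star a).le.trans ha.le)

instance instNonUnitalNormedRing : NonUnitalNormedRing (T.Fibre x) :=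
  { instNormedAddCommGroup T x, instMul T x with
    left_distrib := by
      simp only [forall_mk, ← map_add, ← mk_mul, mul_add, implies_true]
    right_distrib := by
      simp only [forall_mk, ← map_add, ← mk_mul, add_mul, implies_true]
    zero_mul := by
      simp only [forall_mk, ← map_zero (mk T x), ← mk_mul, zero_mul, implies_true]
    mul_zero := by
      simp only [forall_mk, ← map_zero (mk T x), ← mk_mul, mul_zero, implies_true]
    mul_assoc := by
      simp only [forall_mk, ← mk_mul, mul_assoc, implies_true]
    norm_mul_le := norm_mul_le_aux T x }

instance instStarRing : StarRing (T.Fibre x) :=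
  { instStar T x with
    star_involutive := by
      simp only [Function.Involutive, forall_mk, ← mk_star, star_star, implies_true]
    star_mul := by
      simp only [forall_mk, ← mk_star, ← mk_mul, star_mul, implies_true]
    star_add := by
      simp only [forall_mk, ← mk_star, ← map_add, star_add, implies_true] }

instance instNormedStarGroup : NormedStarGroup (T.Fibre x) where
  norm_star_le := norm_star_aux T x

instance instStarModule : StarModule ℂ (T.Fibre x) where
  star_smul := by
    simp only [forall_mk, ← mk_star, ← map_smul, star_smul, implies_true]

instance instIsScalarTower : IsScalarTower ℂ (T.Fibre x) (T.Fibre x) where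
  smul_assoc := by
    simp only [forall_mk, smul_eq_mul, ← mk_mul, ← map_smul, smul_mul_assoc, implies_true]

instance instSMulCommClass : SMulCommClass ℂ (T.Fibre x) (T.Fibre x) where
  smul_comm := by
    simp only [forall_mk, smul_eq_mul, ← mk_mul, ← map_smul, mul_smul_comm, implies_true]

end Fibre

/-- The value `a(x) ∈ A_x` of `a ∈ A` at `x`. -/
def value (a : A) (x : X) : T.Fibre x := Fibre.mk T x a

/-- The set `X_A` of the points with nonzero fibre. -/
def support : Set X := {x | T.J x ≠ ⊤}

/-- Continuity of a cross-section defined on a subset `Y` of the base space. -/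
def IsContinuousSection (Y : Set X) (b : ∀ y : Y, T.Fibre (y : X)) : Prop :=
  ∀ x : Y, ∀ ε : ℝ, 0 < ε → ∃ U ∈ 𝓝 x, ∃ a : A, ∀ y ∈ U, ‖b y - T.value a y‖ < ε

theorem isContinuousSection_value (Y : Set X) (a : A) :
    T.IsContinuousSection Y (fun y => T.value a y) :=
  fun _ ε hε => ⟨Set.univ, univ_mem, a, fun y _ => by simpa using hε⟩

variable {T} in
theorem IsContinuousSection.exists_norm_le {Y : Set X} {b : ∀ y : Y, T.Fibre (y : X)}
    (hb : T.IsContinuousSection Y b) (x : Y) : ∃ U ∈ 𝓝 x, ∃ C : ℝ, ∀ y ∈ U, ‖b y‖ ≤ C := by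
  obtain ⟨U, hU, a, ha⟩ := hb x 1 one_pos
  refine ⟨U, hU, 1 + ‖a‖, fun y hy => ?_⟩
  have h1 : ‖b y‖ ≤ ‖b y - T.value a y‖ + ‖T.value a y‖ := by
    simpa using norm_add_le (b y - T.value a y) (T.value a y)
  exact h1.trans (add_le_add (ha y hy).le (Fibre.norm_mk_le T _ a))

variable {T} in
theorem IsContinuousSection.mul {Y : Set X} {b c : ∀ y : Y, T.Fibre (y : X)}
    (hb : T.IsContinuousSection Y b) (hc : T.IsContinuousSection Y c) :
    T.IsContinuousSection Y (b * c) := by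
  intro x ε hε
  obtain ⟨U, hU, C, hC⟩ := hc.exists_norm_le x
  have hC' : ∀ y ∈ U, ‖c y‖ ≤ |C| := fun y hy => (hC y hy).trans (le_abs_self C)
  obtain ⟨V, hV, a, ha⟩ := hb x (ε / 2 / (|C| + 1)) (by positivity)
  obtain ⟨W, hW, d, hd⟩ := hc x (ε / 2 / (‖a‖ + 1)) (by positivity)
  refine ⟨U ∩ V ∩ W, inter_mem (inter_mem hU hV) hW, a * d, fun y hy => ?_⟩
  have e1 : (b * c) y - T.value (a * d) y
      = (b y - T.value a y) * c y + T.value a y * (c y - T.value d y) := by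
    change b y * c y - T.value a y * T.value d y = _
    noncomm_ring
  rw [e1]
  have n1 : ‖(b y - T.value a y) * c y‖ ≤ ε / 2 / (|C| + 1) * |C| :=
    (norm_mul_le _ _).trans
      (mul_le_mul (ha y hy.1.2).le (hC' y hy.1.1) (norm_nonneg _) (by positivity))
  have n2 : ‖T.value a y * (c y - T.value d y)‖ ≤ ‖a‖ * (ε / 2 / (‖a‖ + 1)) :=
    (norm_mul_le _ _).trans
      (mul_le_mul (Fibre.norm_mk_le T _ a) (hd y hy.2).le (norm_nonneg _) (norm_nonneg _))
  have m1 : ε / 2 / (|C| + 1) * |C| < ε / 2 := by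
    rw [div_mul_eq_mul_div, div_lt_iff₀ (by positivity)]
    nlinarith [abs_nonneg C]
  have m2 : ‖a‖ * (ε / 2 / (‖a‖ + 1)) < ε / 2 := by
    rw [mul_div_assoc', div_lt_iff₀ (by positivity)]
    nlinarith [norm_nonneg a]
  linarith [norm_add_le ((b y - T.value a y) * c y) (T.value a y * (c y - T.value d y))]

/-- The `*`-algebra `Γᵇ(A)` of the bounded continuous sections on `X_A`, with pointwise
operations. -/
def boundedSections : NonUnitalStarSubalgebra ℂ (∀ x : T.support, T.Fibre (x : X)) where
  carrier := {b | T.IsContinuousSection T.support b ∧ ∃ C : ℝ, ∀ x, ‖b x‖ ≤ C}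
  add_mem' := by
    rintro b c ⟨hb, C, hC⟩ ⟨hc, D, hD⟩
    refine ⟨?_, C + D, fun x => (norm_add_le _ _).trans (add_le_add (hC x) (hD x))⟩
    intro x ε hε
    obtain ⟨U, hU, a, ha⟩ := hb x (ε / 2) (half_pos hε)
    obtain ⟨V, hV, d, hd⟩ := hc x (ε / 2) (half_pos hε)
    refine ⟨U ∩ V, inter_mem hU hV, a + d, fun y hy => ?_⟩
    have e1 : (b + c) y - T.value (a + d) y
        = (b y - T.value a y) + (c y - T.value d y) := by
      have : T.value (a + d) (y : X) = T.value a y + T.value d y := map_add _ _ _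
      rw [this, Pi.add_apply]
      abel
    rw [e1]
    linarith [norm_add_le (b y - T.value a y) (c y - T.value d y), ha y hy.1, hd y hy.2]
  zero_mem' := by
    refine ⟨?_, 0, fun x => by simp⟩
    simpa [value] using! T.isContinuousSection_value T.support 0
  mul_mem' := by
    rintro b c ⟨hb, C, hC⟩ ⟨hc, D, hD⟩
    refine ⟨hb.mul hc, C * D, fun x => (norm_mul_le _ _).trans ?_⟩
    exact mul_le_mul (hC x) (hD x) (norm_nonneg _) ((norm_nonneg _).trans (hC x))
  smul_mem' := by
    rintro r b ⟨hb, C, hC⟩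
    refine ⟨?_, ‖r‖ * C, fun x => ?_⟩
    · intro x ε hε
      obtain ⟨U, hU, a, ha⟩ := hb x (ε / (‖r‖ + 1)) (by positivity)
      refine ⟨U, hU, r • a, fun y hy => ?_⟩
      have e1 : (r • b) y - T.value (r • a) y = r • (b y - T.value a y) := by
        have : T.value (r • a) (y : X) = r • T.value a y := map_smul _ _ _
        rw [this, Pi.smul_apply, smul_sub]
      rw [e1, norm_smul]
      have h2 : ‖r‖ * ‖b y - T.value a y‖ ≤ ‖r‖ * (ε / (‖r‖ + 1)) :=
        mul_le_mul_of_nonneg_left (ha y hy).le (norm_nonneg r)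
      refine h2.trans_lt ?_
      rw [mul_div_assoc', div_lt_iff₀ (by positivity)]
      nlinarith [norm_nonneg r]
    · rw [Pi.smul_apply, norm_smul]
      exact mul_le_mul_of_nonneg_left (hC x) (norm_nonneg r)
  star_mem' := by
    rintro b ⟨hb, C, hC⟩
    refine ⟨?_, C, fun x => by rw [Pi.star_apply, norm_star]; exact hC x⟩
    intro x ε hε
    obtain ⟨U, hU, a, ha⟩ := hb x ε hε
    refine ⟨U, hU, star a, fun y hy => ?_⟩
    have e1 : (star b) y - T.value (star a) y = star (b y - T.value a y) := by
      rw [star_sub]; rfl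
    rw [e1, norm_star]
    exact ha y hy

/-- A continuous `C₀(X)`-algebra: all norm functions `x ↦ ‖a(x)‖` are continuous. -/
def IsContinuous : Prop := ∀ a : A, Continuous fun x : X => ‖T.value a x‖

/-! ### The multiplier algebra as a `C(βX)`-algebra -/

theorem eq_of_forall_μ {a b : A} (h : ∀ g : C₀(X, ℂ), (T.μ g).fst a = (T.μ g).fst b) :
    a = b := by
  obtain ⟨k, d, hd⟩ := T.nondegenerate (a - b)
  have h0 : ∀ g : C₀(X, ℂ), (T.μ g).fst (a - b) = 0 := fun g => by rw [map_sub, h, sub_self]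
  have h1 : star (a - b) * (a - b) = 0 := by
    have h2 : (T.μ k).fst (star (a - b)) = 0 := by
      have := T.star_μ (star k) (a - b)
      rw [star_star] at this
      rw [← this, h0, star_zero]
    conv_lhs => rw [← hd, mul_μ, MultiplierAux.fst_mul, hd, h2, zero_mul]
  exact sub_eq_zero.mp ((CStarRing.star_mul_self_eq_zero_iff _).mp h1)

/-- The product `u|_X · g ∈ C₀(X)` of a continuous function `u` on `βX` and `g ∈ C₀(X)`. -/
def restrictMul (u : C₀(StoneCech X, ℂ)) (g : C₀(X, ℂ)) : C₀(X, ℂ) where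
  toFun x := u (stoneCechUnit x) * g x
  continuous_toFun :=
    ((map_continuous u).comp continuous_stoneCechUnit).mul (map_continuous g)
  zero_at_infty' := by
    have hg : Tendsto (fun x => ‖u.toBCF‖ * ‖g x‖) (cocompact X) (𝓝 0) := by
      simpa using ((zero_at_infty g).norm.const_mul ‖u.toBCF‖)
    refine squeeze_zero_norm (fun x => ?_) hg
    rw [norm_mul]
    exact mul_le_mul_of_nonneg_right (u.toBCF.norm_coe_le_norm _) (norm_nonneg _)

theorem exists_extension (u : C₀(StoneCech X, ℂ)) (a : A) :
    ∃ c : A, ∀ g : C₀(X, ℂ), (T.μ g).fst c = (T.μ (restrictMul u g)).fst a := by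
  obtain ⟨k, b, rfl⟩ := T.nondegenerate a
  refine ⟨(T.μ (restrictMul u k)).fst b, fun g => ?_⟩
  rw [← μ_mul, ← μ_mul]
  refine congrArg (fun h => (T.μ h).fst _) (ZeroAtInftyContinuousMap.ext fun x => ?_)
  change g x * (u (stoneCechUnit x) * k x) = u (stoneCechUnit x) * g x * k x
  ring

/-- The element `u · a` of `A`, for a continuous function `u` on `βX`; it is the unique element
with `μ(g) (u · a) = μ(u|_X · g) a` for all `g ∈ C₀(X)`. -/
def extAct (u : C₀(StoneCech X, ℂ)) (a : A) : A := (T.exists_extension u a).choose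

theorem μ_extAct (u : C₀(StoneCech X, ℂ)) (a : A) (g : C₀(X, ℂ)) :
    (T.μ g).fst (T.extAct u a) = (T.μ (restrictMul u g)).fst a :=
  (T.exists_extension u a).choose_spec g

/-- The action of `u` as a bounded linear map on `A`. -/
def extCLM (u : C₀(StoneCech X, ℂ)) : A →L[ℂ] A :=
  ContinuousLinearMap.ofSeqClosedGraph
    (g := { toFun := T.extAct u
            map_add' := fun a b => T.eq_of_forall_μ fun g => by simp only [map_add, μ_extAct]
            map_smul' := fun c a => T.eq_of_forall_μ fun g => by
              simp only [map_smul, μ_extAct, RingHom.id_apply] })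
    (by
      intro w a c hw hc
      refine T.eq_of_forall_μ fun g => ?_
      have h1 : Tendsto (fun n => (T.μ g).fst (T.extAct u (w n))) atTop (𝓝 ((T.μ g).fst c)) :=
        ((T.μ g).fst.continuous.tendsto c).comp hc
      have h2 : Tendsto (fun n => (T.μ (restrictMul u g)).fst (w n)) atTop
          (𝓝 ((T.μ (restrictMul u g)).fst a)) :=
        ((T.μ (restrictMul u g)).fst.continuous.tendsto a).comp hw
      simp only [μ_extAct] at h1
      change (T.μ g).fst c = (T.μ g).fst (T.extAct u a)
      rw [μ_extAct]
      exact tendsto_nhds_unique h1 h2)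

theorem μ_extCLM (u : C₀(StoneCech X, ℂ)) (a : A) (g : C₀(X, ℂ)) :
    (T.μ g).fst (T.extCLM u a) = (T.μ (restrictMul u g)).fst a :=
  T.μ_extAct u a g

/-- The multiplier of `A` defined by a continuous function on `βX`. -/
def extMultiplier (u : C₀(StoneCech X, ℂ)) : 𝓜(ℂ, A) where
  fst := T.extCLM u
  snd := T.extCLM u
  central x y := T.eq_of_forall_μ fun g => by
    rw [MultiplierAux.fst_mul, μ_extCLM, ← mul_μ, μ_extCLM, mul_μ, MultiplierAux.fst_mul]

/-- The structure map `C(βX) → Z M(A)` extending `μ`. -/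
def μExt : C₀(StoneCech X, ℂ) →⋆ₙₐ[ℂ] 𝓜(ℂ, A) where
  toFun := T.extMultiplier
  map_smul' c u := MultiplierAux.ext_fst fun a => T.eq_of_forall_μ fun g => by
    change (T.μ g).fst (T.extCLM (c • u) a) = (T.μ g).fst (c • T.extCLM u a)
    rw [map_smul, μ_extCLM, μ_extCLM]
    have : restrictMul (c • u) g = c • restrictMul u g := by
      ext x
      change c * u (stoneCechUnit x) * g x = c * (u (stoneCechUnit x) * g x)
      ring
    rw [this, map_smul]; rfl
  map_zero' := MultiplierAux.ext_fst fun a => T.eq_of_forall_μ fun g => by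
    change (T.μ g).fst (T.extCLM 0 a) = (T.μ g).fst 0
    rw [map_zero, μ_extCLM]
    have : restrictMul (0 : C₀(StoneCech X, ℂ)) g = 0 := by
      ext x
      change (0 : ℂ) * g x = 0
      ring
    rw [this, map_zero]; rfl
  map_add' u w := MultiplierAux.ext_fst fun a => T.eq_of_forall_μ fun g => by
    change (T.μ g).fst (T.extCLM (u + w) a) = (T.μ g).fst (T.extCLM u a + T.extCLM w a)
    rw [map_add, μ_extCLM, μ_extCLM, μ_extCLM]
    have : restrictMul (u + w) g = restrictMul u g + restrictMul w g := by
      ext x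
      change (u (stoneCechUnit x) + w (stoneCechUnit x)) * g x
        = u (stoneCechUnit x) * g x + w (stoneCechUnit x) * g x
      ring
    rw [this, map_add]; rfl
  map_mul' u w := MultiplierAux.ext_fst fun a => T.eq_of_forall_μ fun g => by
    change (T.μ g).fst (T.extCLM (u * w) a) = (T.μ g).fst (T.extCLM u (T.extCLM w a))
    rw [μ_extCLM, μ_extCLM, μ_extCLM]
    refine congrArg (fun h => (T.μ h).fst _) (ZeroAtInftyContinuousMap.ext fun x => ?_)
    change u (stoneCechUnit x) * w (stoneCechUnit x) * g x
      = w (stoneCechUnit x) * (u (stoneCechUnit x) * g x)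
    ring
  map_star' u := MultiplierAux.ext_fst fun a => T.eq_of_forall_μ fun g => by
    change (T.μ g).fst (T.extCLM (star u) a) = (T.μ g).fst (star (T.extCLM u (star a)))
    have h := T.star_μ (star g) (T.extCLM u (star a))
    rw [star_star] at h
    rw [← h, μ_extCLM, μ_extCLM, star_μ, star_star]
    refine congrArg (fun h => (T.μ h).fst _) (ZeroAtInftyContinuousMap.ext fun x => ?_)
    change star (u (stoneCechUnit x)) * g x = star (u (stoneCechUnit x) * star (g x))
    rw [star_mul, star_star, mul_comm]

theorem μExt_central (u : C₀(StoneCech X, ℂ)) (m : 𝓜(ℂ, A)) :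
    T.μExt u * m = m * T.μExt u :=
  MultiplierAux.central_of_fst_eq_snd (fun _ => rfl) m

/-- The constant function `1` on `βX`. -/
def oneFun : C₀(StoneCech X, ℂ) where
  toFun _ := 1
  continuous_toFun := continuous_const
  zero_at_infty' := by simp

theorem μExt_one : T.μExt oneFun = 1 :=
  MultiplierAux.ext_fst fun a => T.eq_of_forall_μ fun g => by
    change (T.μ g).fst (T.extCLM _ a) = (T.μ g).fst a
    rw [μ_extCLM]
    refine congrArg (fun h => (T.μ h).fst _) (ZeroAtInftyContinuousMap.ext fun x => ?_)
    change (1 : ℂ) * g x = g x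
    ring

/-- The multiplier algebra of a `C₀(X)`-algebra, as a `C(βX)`-algebra. -/
def multiplierAlgebra : CZeroAlgebra (StoneCech X) 𝓜(ℂ, A) where
  μ := (DoubleCentralizer.coeHom (𝕜 := ℂ) (A := 𝓜(ℂ, A))).comp T.μExt
  central u m := MultiplierAux.central_of_fst_eq_snd
    (fun a => T.μExt_central u a) m
  nondegenerate m := ⟨oneFun, m, by
    change T.μExt _ * m = m
    rw [μExt_one, one_mul]⟩

/-- The ideal `H_y` of `M(A)`, for `y ∈ βX`. -/
def H (y : StoneCech X) : Submodule ℂ 𝓜(ℂ, A) := T.multiplierAlgebra.J y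

/-! ### The algebra `A^β` -/

/-- `A^β` is the intersection of the `A + H_x` over `x ∈ X_A`, inside `M(A)`. -/
def beta : NonUnitalStarSubalgebra ℂ 𝓜(ℂ, A) where
  carrier := {m | ∀ x ∈ T.support, ∃ a : A, m - (a : 𝓜(ℂ, A)) ∈ T.H (stoneCechUnit x)}
  add_mem' := by
    intro m n hm hn x hx
    obtain ⟨a, ha⟩ := hm x hx
    obtain ⟨b, hb⟩ := hn x hx
    refine ⟨a + b, ?_⟩
    have : m + n - ((a + b : A) : 𝓜(ℂ, A)) = (m - (a : 𝓜(ℂ, A))) + (n - (b : 𝓜(ℂ, A))) := by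
      have : ((a + b : A) : 𝓜(ℂ, A)) = (a : 𝓜(ℂ, A)) + (b : 𝓜(ℂ, A)) :=
        map_add (DoubleCentralizer.coeHom (𝕜 := ℂ) (A := A)) a b
      rw [this]; abel
    rw [this]
    exact add_mem ha hb
  zero_mem' := fun x _ => ⟨0, by
    have : ((0 : A) : 𝓜(ℂ, A)) = 0 := map_zero (DoubleCentralizer.coeHom (𝕜 := ℂ) (A := A))
    rw [this, sub_zero]; exact zero_mem _⟩
  mul_mem' := by
    intro m n hm hn x hx
    obtain ⟨b, hb⟩ := hn x hx
    refine ⟨m.fst b, ?_⟩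
    rw [← MultiplierAux.mul_coe, ← mul_sub]
    exact T.multiplierAlgebra.mul_mem_J_left m hb
  smul_mem' := by
    intro c m hm x hx
    obtain ⟨a, ha⟩ := hm x hx
    refine ⟨c • a, ?_⟩
    have : ((c • a : A) : 𝓜(ℂ, A)) = c • (a : 𝓜(ℂ, A)) :=
      map_smul (DoubleCentralizer.coeHom (𝕜 := ℂ) (A := A)) c a
    rw [this, ← smul_sub]
    exact Submodule.smul_mem _ _ ha
  star_mem' := by
    intro m hm x hx
    obtain ⟨a, ha⟩ := hm x hx
    refine ⟨star a, ?_⟩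
    have : ((star a : A) : 𝓜(ℂ, A)) = star (a : 𝓜(ℂ, A)) :=
      map_star (DoubleCentralizer.coeHom (𝕜 := ℂ) (A := A)) a
    rw [this, ← star_sub]
    exact T.multiplierAlgebra.star_mem_J ha

theorem coe_mem_beta (a : A) : (a : 𝓜(ℂ, A)) ∈ T.beta :=
  fun _ _ => ⟨a, by rw [sub_self]; exact zero_mem _⟩

/-- The inclusion of `A` in `A^β`. -/
def toBeta (a : A) : T.beta := ⟨(a : 𝓜(ℂ, A)), T.coe_mem_beta a⟩

theorem mul_mem_beta_left (z : 𝓜(ℂ, A)) {m : 𝓜(ℂ, A)} (hm : m ∈ T.beta) : z * m ∈ T.beta := by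
  intro x hx
  obtain ⟨b, hb⟩ := hm x hx
  refine ⟨z.fst b, ?_⟩
  rw [← MultiplierAux.mul_coe, ← mul_sub]
  exact T.multiplierAlgebra.mul_mem_J_left z hb

theorem mul_mem_beta_right (z : 𝓜(ℂ, A)) {m : 𝓜(ℂ, A)} (hm : m ∈ T.beta) : m * z ∈ T.beta := by
  have := star_mem (T.mul_mem_beta_left (star z) (star_mem hm))
  simpa using this

theorem norm_coe_eq (a : A) : ‖(a : 𝓜(ℂ, A))‖ = ‖a‖ := by
  rw [← DoubleCentralizer.norm_fst, DoubleCentralizer.coe_fst,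
    ContinuousLinearMap.opNorm_mul_apply]

/-- In a C*-algebra the sum of the closed ideals `A` and `H_y` of `M(A)` is closed. -/
theorem isClosed_add_H (y : StoneCech X) :
    IsClosed {m : 𝓜(ℂ, A) | ∃ a : A, m - (a : 𝓜(ℂ, A)) ∈ T.H y} := by
  let S := T.multiplierAlgebra
  let mk := Fibre.mk S y
  let f : NormedAddGroupHom A (S.Fibre y) :=
    { toFun := fun a => mk (a : 𝓜(ℂ, A))
      map_add' := fun a b => by
        rw [← map_add]
        exact congrArg mk (map_add (DoubleCentralizer.coeHom (𝕜 := ℂ) (A := A)) a b)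
      bound' := ⟨1, fun a => by
        rw [one_mul, ← norm_coe_eq a]
        exact Fibre.norm_mk_le S y _⟩ }
  have hf : ∀ a, f a = mk (a : 𝓜(ℂ, A)) := fun a => rfl
  have hsurj : f.SurjectiveOnWith f.range 2 := by
    rintro h ⟨α, rfl⟩
    change ∃ g, f g = f α ∧ ‖g‖ ≤ 2 * ‖f α‖
    by_cases h0 : f α = 0
    · exact ⟨0, by rw [h0, map_zero], by simp⟩
    have hpos : 0 < ‖f α‖ := norm_pos_iff.mpr h0
    obtain ⟨m, hm, hmn⟩ := Fibre.norm_mk_lt S y (f α) (ε := ‖f α‖ / 2) (by positivity)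
    have hη : m - (α : 𝓜(ℂ, A)) ∈ S.J y := (Fibre.mk_eq_mk S y).mp hm
    let _ := CStarAlgebra.spectralOrder A
    have _ := CStarAlgebra.spectralOrderedRing A
    have hau := CStarAlgebra.increasingApproximateUnit A
    have hnb := hau.neBot
    have h1 : ∀ᶠ e in CStarAlgebra.approximateUnit A, ‖α * e - α‖ < ‖f α‖ / 2 := by
      have := (hau.tendsto_mul_left α)
      have := Metric.tendsto_nhds.mp this (‖f α‖ / 2) (by positivity)
      simpa [dist_eq_norm] using this
    obtain ⟨e, he1, he2⟩ := (h1.and hau.eventually_norm).exists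
    let η : 𝓜(ℂ, A) := m - (α : 𝓜(ℂ, A))
    refine ⟨α + η.fst e, ?_, ?_⟩
    · rw [hf, hf]
      refine (Fibre.mk_eq_mk S y).mpr ?_
      have : ((α + η.fst e : A) : 𝓜(ℂ, A)) - (α : 𝓜(ℂ, A)) = η * (e : 𝓜(ℂ, A)) := by
        rw [MultiplierAux.mul_coe]
        have : ((α + η.fst e : A) : 𝓜(ℂ, A)) = (α : 𝓜(ℂ, A)) + (η.fst e : A) :=
          map_add (DoubleCentralizer.coeHom (𝕜 := ℂ) (A := A)) _ _
        rw [this]; abel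
      rw [this]
      exact S.mul_mem_J_right _ hη
    · have e1 : α + η.fst e = (α - α * e) + m.fst e := by
        have : η.fst e = m.fst e - α * e := by
          simp only [η, DoubleCentralizer.sub_fst, DoubleCentralizer.coe_fst]
          rfl
        rw [this]; abel
      have n1 : ‖m.fst e‖ ≤ ‖m‖ := by
        refine (m.fst.le_opNorm e).trans ?_
        rw [DoubleCentralizer.norm_fst]
        exact mul_le_of_le_one_right (norm_nonneg _) he2
      have n2 : ‖α - α * e‖ < ‖f α‖ / 2 := by rw [norm_sub_rev]; exact he1
      rw [e1]
      linarith [norm_add_le (α - α * e) (m.fst e)]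
  have hcl := controlled_closure_of_complete (two_pos) (one_pos) hsurj
  have hr : IsClosed (Set.range f) := by
    refine isClosed_of_closure_subset fun z hz => ?_
    obtain ⟨g, hg, -⟩ := hcl z (by
      change z ∈ closure (f.range : Set (S.Fibre y))
      have hr : (f.range : Set (S.Fibre y)) = Set.range f := rfl
      rwa [hr])
    exact ⟨g, hg⟩
  have hmk : Continuous mk :=
    (AddMonoidHomClass.lipschitz_of_bound mk 1 fun m => by
      rw [one_mul]; exact Fibre.norm_mk_le S y m).continuous
  have heq : {m : 𝓜(ℂ, A) | ∃ a : A, m - (a : 𝓜(ℂ, A)) ∈ T.H y} = mk ⁻¹' Set.range f := by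
    ext m
    constructor
    · rintro ⟨a, ha⟩
      exact ⟨a, ((Fibre.mk_eq_mk S y).mpr ha).symm⟩
    · rintro ⟨a, ha⟩
      exact ⟨a, (Fibre.mk_eq_mk S y).mp ha.symm⟩
  rw [heq]
  exact hr.preimage hmk

theorem isClosed_beta : IsClosed (T.beta : Set 𝓜(ℂ, A)) := by
  have : (T.beta : Set 𝓜(ℂ, A)) = ⋂ x ∈ T.support,
      {m : 𝓜(ℂ, A) | ∃ a : A, m - (a : 𝓜(ℂ, A)) ∈ T.H (stoneCechUnit x)} := by
    ext m
    simp only [Set.mem_iInter]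
    rfl
  rw [this]
  exact isClosed_biInter fun x _ => T.isClosed_add_H _

instance instCStarBeta : NonUnitalCStarAlgebra T.beta :=
  NonUnitalStarSubalgebra.nonUnitalCStarAlgebra T.beta (h_closed := T.isClosed_beta)

/-- The multiplier of the ideal `A^β` of `M(A)` given by multiplication by `z ∈ M(A)`. -/
def betaMultiplier (z : 𝓜(ℂ, A)) : 𝓜(ℂ, T.beta) where
  fst := LinearMap.mkContinuous
    { toFun := fun m : T.beta => (⟨z * m, T.mul_mem_beta_left z m.2⟩ : T.beta)
      map_add' := fun m n => Subtype.ext (mul_add z (m : 𝓜(ℂ, A)) n)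
      map_smul' := fun c m => Subtype.ext (mul_smul_comm c z (m : 𝓜(ℂ, A))) }
    ‖z‖ fun m => norm_mul_le z (m : 𝓜(ℂ, A))
  snd := LinearMap.mkContinuous
    { toFun := fun m : T.beta => (⟨m * z, T.mul_mem_beta_right z m.2⟩ : T.beta)
      map_add' := fun m n => Subtype.ext (add_mul (m : 𝓜(ℂ, A)) n z)
      map_smul' := fun c m => Subtype.ext (smul_mul_assoc c (m : 𝓜(ℂ, A)) z) }
    ‖z‖ fun m => (norm_mul_le (m : 𝓜(ℂ, A)) z).trans_eq (mul_comm _ _)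
  central m n := Subtype.ext (mul_assoc (m : 𝓜(ℂ, A)) z n)

/-- The canonical `*`-homomorphism `M(A) → M(A^β)`. -/
def betaHom : 𝓜(ℂ, A) →⋆ₙₐ[ℂ] 𝓜(ℂ, T.beta) where
  toFun := T.betaMultiplier
  map_smul' c z := MultiplierAux.ext_fst fun m => Subtype.ext (smul_mul_assoc c z (m : 𝓜(ℂ, A)))
  map_zero' := MultiplierAux.ext_fst fun m => Subtype.ext (zero_mul (m : 𝓜(ℂ, A)))
  map_add' z w := MultiplierAux.ext_fst fun m => Subtype.ext (add_mul z w (m : 𝓜(ℂ, A)))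
  map_mul' z w := MultiplierAux.ext_fst fun m => Subtype.ext (mul_assoc z w (m : 𝓜(ℂ, A)))
  map_star' z := MultiplierAux.ext_fst fun m => Subtype.ext (by
    change star z * (m : 𝓜(ℂ, A)) = star (star (m : 𝓜(ℂ, A)) * z)
    rw [star_mul, star_star])

/-- `A^β` as a `C(βX)`-algebra: `C(βX)` acts by multiplication inside `M(A)`. -/
def betaAlgebra : CZeroAlgebra (StoneCech X) T.beta where
  μ := T.betaHom.comp T.μExt
  central u m := MultiplierAux.central_of_fst_eq_snd
    (fun a => Subtype.ext (T.μExt_central u (a : 𝓜(ℂ, A)))) m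
  nondegenerate m := ⟨oneFun, m, Subtype.ext (by
    change T.μExt _ * (m : 𝓜(ℂ, A)) = m
    rw [μExt_one, one_mul])⟩

end CZeroAlgebra

/-! ### The trivial `C₀(X)`-algebra -/

namespace TrivialCZeroAlgebra

variable (X : Type u) (B : Type v) [TopologicalSpace X] [NonUnitalCStarAlgebra B]

variable {X B} in
/-- The pointwise product of `f ∈ C₀(X)` and `F ∈ C₀(X, B)`. -/
def smulFun (f : C₀(X, ℂ)) (F : C₀(X, B)) : C₀(X, B) where
  toFun x := f x • F x
  continuous_toFun := (map_continuous f).smul (map_continuous F)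
  zero_at_infty' := by simpa using! (zero_at_infty f).smul (zero_at_infty F)

variable {X B} in
theorem norm_smulFun_le (f : C₀(X, ℂ)) (F : C₀(X, B)) : ‖smulFun f F‖ ≤ ‖f‖ * ‖F‖ := by
  rw [← ZeroAtInftyContinuousMap.norm_toBCF_eq_norm,
    ← ZeroAtInftyContinuousMap.norm_toBCF_eq_norm, ← ZeroAtInftyContinuousMap.norm_toBCF_eq_norm,
    BoundedContinuousFunction.norm_le (by positivity)]
  intro x
  change ‖f x • F x‖ ≤ _
  rw [norm_smul]
  exact mul_le_mul (f.toBCF.norm_coe_le_norm x) (F.toBCF.norm_coe_le_norm x) (norm_nonneg _)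
    (norm_nonneg _)

variable {X B} in
/-- Pointwise multiplication by `f ∈ C₀(X)`, as a bounded linear map on `C₀(X, B)`. -/
def smulCLM (f : C₀(X, ℂ)) : C₀(X, B) →L[ℂ] C₀(X, B) :=
  LinearMap.mkContinuous
    { toFun := smulFun f
      map_add' := fun F G => by ext x; exact smul_add (f x) (F x) (G x)
      map_smul' := fun c F => by ext x; exact smul_comm (f x) c (F x) }
    ‖f‖ (norm_smulFun_le f)

variable {X B} in
/-- Pointwise multiplication by `f ∈ C₀(X)`, as a multiplier of `C₀(X, B)`. -/
def smulMultiplier (f : C₀(X, ℂ)) : 𝓜(ℂ, C₀(X, B)) where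
  fst := smulCLM f
  snd := smulCLM f
  central F G := by
    ext x
    change (f x • F x) * G x = F x * (f x • G x)
    rw [smul_mul_assoc, mul_smul_comm]

/-- The structure map of the trivial `C₀(X)`-algebra. -/
def structureMap : C₀(X, ℂ) →⋆ₙₐ[ℂ] 𝓜(ℂ, C₀(X, B)) where
  toFun := smulMultiplier
  map_smul' c f := MultiplierAux.ext_fst fun F => by
    ext x; exact smul_assoc c (f x) (F x)
  map_zero' := MultiplierAux.ext_fst fun F => by
    ext x; exact zero_smul ℂ (F x)
  map_add' f g := MultiplierAux.ext_fst fun F => by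
    ext x; exact add_smul (f x) (g x) (F x)
  map_mul' f g := MultiplierAux.ext_fst fun F => by
    ext x; exact mul_smul (f x) (g x) (F x)
  map_star' f := MultiplierAux.ext_fst fun F => by
    ext x
    change star (f x) • F x = star (f x • star (F x))
    rw [star_smul, star_star]

variable {X B} in
theorem exists_factorization (F : C₀(X, B)) :
    ∃ (f : C₀(X, ℂ)) (G : C₀(X, B)), smulFun f G = F := by
  have hs : Tendsto (fun x => √‖F x‖) (cocompact X) (𝓝 0) := by
    have h1 : Tendsto (fun x => ‖F x‖) (cocompact X) (𝓝 0) := by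
      simpa using (zero_at_infty F).norm
    simpa using! (Real.continuous_sqrt.tendsto 0).comp h1
  have hsc : Continuous fun x => √‖F x‖ :=
    Real.continuous_sqrt.comp (map_continuous F).norm
  have hn : ∀ x, ‖((√‖F x‖ : ℝ) : ℂ)⁻¹ • F x‖ = √‖F x‖ := by
    intro x
    rw [norm_smul, norm_inv, Complex.norm_real, Real.norm_of_nonneg (Real.sqrt_nonneg _)]
    rcases eq_or_ne (F x) 0 with h | h
    · simp [h]
    · have hp : 0 < √‖F x‖ := Real.sqrt_pos.mpr (norm_pos_iff.mpr h)
      rw [inv_mul_eq_div, div_eq_iff hp.ne', Real.mul_self_sqrt (norm_nonneg _)]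
  refine ⟨⟨⟨fun x => ((√‖F x‖ : ℝ) : ℂ), Complex.continuous_ofReal.comp hsc⟩, ?_⟩,
    ⟨⟨fun x => ((√‖F x‖ : ℝ) : ℂ)⁻¹ • F x, ?_⟩, ?_⟩, ?_⟩
  · simpa using! (Complex.continuous_ofReal.tendsto 0).comp hs
  · refine continuous_iff_continuousAt.mpr fun x => ?_
    rcases eq_or_ne (F x) 0 with h | h
    · have h0 : ((√‖F x‖ : ℝ) : ℂ)⁻¹ • F x = 0 := by rw [h, smul_zero]
      rw [ContinuousAt, h0, tendsto_zero_iff_norm_tendsto_zero]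
      simp only [hn]
      have := hsc.tendsto x
      simpa [h] using this
    · have hp : ((√‖F x‖ : ℝ) : ℂ) ≠ 0 :=
        Complex.ofReal_ne_zero.mpr (Real.sqrt_pos.mpr (norm_pos_iff.mpr h)).ne'
      exact ((Complex.continuous_ofReal.comp hsc).continuousAt.inv₀ hp).smul
        (map_continuous F).continuousAt
  · change Tendsto (fun x => ((√‖F x‖ : ℝ) : ℂ)⁻¹ • F x) (cocompact X) (𝓝 0)
    rw [tendsto_zero_iff_norm_tendsto_zero]
    simpa only [hn] using hs
  · ext x
    change ((√‖F x‖ : ℝ) : ℂ) • (((√‖F x‖ : ℝ) : ℂ)⁻¹ • F x) = F x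
    rcases eq_or_ne (F x) 0 with h | h
    · rw [h, smul_zero, smul_zero]
    · have hp : ((√‖F x‖ : ℝ) : ℂ) ≠ 0 :=
        Complex.ofReal_ne_zero.mpr (Real.sqrt_pos.mpr (norm_pos_iff.mpr h)).ne'
      rw [smul_smul, mul_inv_cancel₀ hp, one_smul]

end TrivialCZeroAlgebra

/-- The trivial `C₀(X)`-algebra `C₀(X, B)`: the functions in `C₀(X)` act by pointwise
multiplication. -/
def trivialCZeroAlgebra (X : Type u) (B : Type v) [TopologicalSpace X] [T2Space X]
    [LocallyCompactSpace X] [NonUnitalCStarAlgebra B] : CZeroAlgebra X C₀(X, B) where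
  μ := TrivialCZeroAlgebra.structureMap X B
  central _ m := MultiplierAux.central_of_fst_eq_snd (fun _ => rfl) m
  nondegenerate F := TrivialCZeroAlgebra.exists_factorization F

/-- A space on which every continuous complex-valued function is bounded. -/
def IsPseudocompact (X : Type u) [TopologicalSpace X] : Prop :=
  ∀ f : C(X, ℂ), ∃ C : ℝ, ∀ x, ‖f x‖ ≤ C

end

noncomputable section

/-! ### Extensions to the Stone–Čech compactification -/

/-! Everything rests on computing quotient norms. For `F` in `C₀(X, B)` the norm of `F` modulo `J_x`
is `‖F x‖`: elements of `J_x` vanish at `x`, and the scalar function `f = (‖F‖ - ‖F x‖)⁺ / (‖F‖ +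
ε)` vanishes at `x` and satisfies `‖F - f F‖ ≤ ‖F x‖ + ε` (`norm_value`). Hence evaluation at `x`
and the quotient map have the same kernel, the fibre is `B`, and bounded continuous sections are
bounded continuous functions.

A bounded function `a : X → B` need not extend to a `B`-valued function on `βX`, but its norm
function does; call the extension `normExt a`. The same cutoff, applied to `normExt a`, shows that
`a` lies in `H_x` when `a x = 0`, so that `Cᵇ(X, B) ⊆ A^β`. Conversely, if `m - F ∈ H_x` with `F` in
`A`, then `m` is close to multiplication by `F` near `x`, so `m` is multiplication by a continuous
function (`exists_bddMultiplier_eq`). Once `A^β = Cᵇ(X, B)`, the fibre norm of `a` at any `y` in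
`βX` is `normExt a y` (`norm_value_betaEquiv`). This gives continuity of `A^β`, its fibres over `X`,
and uniqueness of extended sections, by density of `X`.

The canonical map `C(βX, B) → A^β` is restriction to `X`, injective by density, so the question is
whether each `a` in `Cᵇ(X, B)` extends to `βX`, which amounts to its range being relatively compact.
Bounded sets in finite-dimensional `B` are relatively compact, and every continuous image of a
pseudocompact space in a metric space is totally bounded. Otherwise, an unbounded function on `X`,
followed by a function on `ℂ` that takes the values of a bounded separated sequence of `B`, gives a
bounded function without extension. -/

theorem exists_stoneCech_extension {X Y : Type*} [TopologicalSpace X] [TopologicalSpace Y]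
    [T2Space Y] {K : Set Y} (hK : IsCompact K) {f : X → Y} (hf : Continuous f)
    (hfK : ∀ x, f x ∈ K) :
    ∃ g : C(StoneCech X, Y), (∀ x, g (stoneCechUnit x) = f x) ∧ ∀ y, g y ∈ K := by
  have : CompactSpace K := isCompact_iff_compactSpace.mp hK
  have hf' : Continuous fun x => (⟨f x, hfK x⟩ : K) := hf.subtype_mk hfK
  refine ⟨⟨fun y => (stoneCechExtend hf' y : K), continuous_subtype_val.comp
    (continuous_stoneCechExtend hf')⟩, fun x => ?_, fun y => (stoneCechExtend hf' y).2⟩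
  exact congrArg Subtype.val (congrFun (stoneCechExtend_extends hf') x)

theorem stoneCech_induction {X : Type*} [TopologicalSpace X] {p : StoneCech X → Prop}
    (hp : IsClosed {y | p y}) (h : ∀ x, p (stoneCechUnit x)) (y : StoneCech X) : p y :=
  isClosed_property denseRange_stoneCechUnit hp h y

/-! ### Continuous functions with prescribed values on a separated sequence -/

theorem exists_separated_seq_of_not_totallyBounded {M : Type*} [PseudoMetricSpace M] {s : Set M}
    (hs : ¬ TotallyBounded s) :
    ∃ ε > 0, ∃ z : ℕ → M, (∀ n, z n ∈ s) ∧ ∀ m n, m ≠ n → ε ≤ dist (z m) (z n) := by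
  rw [Metric.totallyBounded_iff] at hs
  push Not at hs
  obtain ⟨ε, hε, h⟩ := hs
  obtain ⟨z, hz, hd⟩ := exists_seq_of_forall_finset_exists (fun x => x ∈ s)
    (fun x y => ε ≤ dist x y) (by
      intro t _
      obtain ⟨y, hy, hyt⟩ := Set.not_subset.mp (h t t.finite_toSet)
      refine ⟨y, hy, fun x hx => ?_⟩
      by_contra hlt
      refine hyt (Set.mem_iUnion₂.mpr ⟨x, hx, ?_⟩)
      rw [Metric.mem_ball, dist_comm]
      exact not_le.mp hlt)
  refine ⟨ε, hε, z, hz, fun m n hmn => ?_⟩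
  rcases lt_or_gt_of_ne hmn with hlt | hlt
  · exact hd m n hlt
  · rw [dist_comm]; exact hd n m hlt

/-- Tents of radius `ε / 3` around the points `z n` have disjoint supports, so at most one term of
the sum is nonzero at a given point. Nothing is assumed on `v`: an unbounded sequence produces an
unbounded `g`, and by the last clause a bounded one produces a bounded `g`. Both uses occur below.
-/
theorem exists_continuous_of_separated_seq {M E : Type*} [PseudoMetricSpace M]
    [NormedAddCommGroup E] [NormedSpace ℝ E] {ε : ℝ} (hε : 0 < ε) {z : ℕ → M}
    (hz : ∀ m n, m ≠ n → ε ≤ dist (z m) (z n)) (v : ℕ → E) :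
    ∃ g : C(M, E), (∀ n, g (z n) = v n) ∧ ∀ x, g x = 0 ∨ ∃ n, ‖g x‖ ≤ ‖v n‖ := by
  let r : ℕ → M → ℝ := fun n x => max 0 (1 - (3 / ε) * dist x (z n))
  have hr0 : ∀ n x, ε / 3 ≤ dist x (z n) → r n x = 0 := by
    intro n x h
    refine max_eq_left ?_
    have : (3 / ε) * (ε / 3) ≤ (3 / ε) * dist x (z n) :=
      mul_le_mul_of_nonneg_left h (by positivity)
    have e : (3 / ε) * (ε / 3) = 1 := by field_simp
    linarith
  have hr1 : ∀ n x, r n x ≤ 1 := by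
    intro n x
    refine max_le zero_le_one ?_
    have : 0 ≤ (3 / ε) * dist x (z n) := by positivity
    linarith
  have hrn : ∀ n x, 0 ≤ r n x := fun n x => le_max_left _ _
  have hnear : ∀ n x, r n x • v n ≠ 0 → dist x (z n) < ε / 3 := by
    intro n x h
    by_contra hge
    exact h (by rw [hr0 n x (not_lt.mp hge), zero_smul])
  have hzero : ∀ x m n, dist x (z m) < ε / 3 → n ≠ m → r n x • v n = 0 := by
    intro x m n hx hnm
    by_contra h
    have h1 := hnear n x h
    have h2 := hz n m hnm
    have h3 := dist_triangle_left (z n) (z m) x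
    linarith
  have hval : ∀ x m, dist x (z m) < ε / 3 → ∑ᶠ n, r n x • v n = r m x • v m := fun x m hx =>
    finsum_eq_single _ m fun n hn => hzero x m n hx hn
  have hcont : Continuous fun x => ∑ᶠ n, r n x • v n := by
    refine continuous_finsum (fun n => ?_) fun x => ?_
    · have : Continuous (r n) := by fun_prop
      exact this.smul continuous_const
    -- Local finiteness: points of this ball are less than `ε / 3` apart, so if two tents met it
    -- their centres would be at distance less than `3 · ε / 3 = ε`.
    · refine ⟨Metric.ball x (ε / 6), Metric.ball_mem_nhds x (by positivity), ?_⟩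
      refine Set.Subsingleton.finite ?_
      rintro m ⟨a, ham, hax⟩ n ⟨b, hbn, hbx⟩
      by_contra hmn
      have h1 := hnear m a ham
      have h2 := hnear n b hbn
      have h3 := hz m n hmn
      rw [Metric.mem_ball] at hax hbx
      have h4 := dist_triangle_left (z m) (z n) a
      have h5 := dist_triangle a b (z n)
      have h6 := dist_triangle_right a b x
      linarith
  refine ⟨⟨fun x => ∑ᶠ n, r n x • v n, hcont⟩, fun n => ?_, fun x => ?_⟩
  · change ∑ᶠ k, r k (z n) • v k = v n
    rw [hval (z n) n (by rw [dist_self]; positivity)]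
    simp [r]
  · by_cases h : ∃ m, dist x (z m) < ε / 3
    · obtain ⟨m, hm⟩ := h
      refine Or.inr ⟨m, ?_⟩
      change ‖∑ᶠ k, r k x • v k‖ ≤ ‖v m‖
      rw [hval x m hm, norm_smul, Real.norm_of_nonneg (hrn m x)]
      exact mul_le_of_le_one_left (norm_nonneg _) (hr1 m x)
    · push Not at h
      refine Or.inl ?_
      change ∑ᶠ k, r k x • v k = 0
      simp only [hr0 _ x (h _), zero_smul, finsum_zero]

/-! ### Pseudocompactness -/

/-- If the range contained a separated sequence, a continuous function taking the value `n` at its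
`n`-th point would, composed with `f`, be unbounded on `X`. -/
theorem IsPseudocompact.totallyBounded_range {X : Type u} {M : Type*} [TopologicalSpace X]
    [PseudoMetricSpace M] (hX : IsPseudocompact X) {f : X → M} (hf : Continuous f) :
    TotallyBounded (Set.range f) := by
  by_contra h
  obtain ⟨ε, hε, z, hzs, hz⟩ := exists_separated_seq_of_not_totallyBounded h
  obtain ⟨g, hg, -⟩ := exists_continuous_of_separated_seq hε hz (fun n => (n : ℂ))
  obtain ⟨C, hC⟩ := hX ⟨fun x => g (f x), g.continuous.comp hf⟩
  obtain ⟨n, hn⟩ := exists_nat_gt C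
  obtain ⟨x, hx⟩ := hzs n
  have := hC x
  change ‖g (f x)‖ ≤ C at this
  rw [hx, hg, Complex.norm_natCast] at this
  linarith

/-- On a space that is not pseudocompact there is a bounded continuous function into any given
infinite-dimensional Banach space whose range is not relatively compact. -/
theorem exists_bounded_not_totallyBounded {X : Type u} [TopologicalSpace X] {E : Type*}
    [NormedAddCommGroup E] [NormedSpace ℂ E] (hX : ¬ IsPseudocompact X)
    (hE : ¬ FiniteDimensional ℂ E) : ∃ a : X →ᵇ E, ¬ TotallyBounded (Set.range a) := by
  obtain ⟨f, hf⟩ := not_forall.mp hX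
  have hnt : ¬ TotallyBounded (Set.range f) := fun h => by
    obtain ⟨C, hC⟩ := h.isBounded.exists_norm_le
    exact hf ⟨C, fun x => hC _ (Set.mem_range_self x)⟩
  obtain ⟨ε, hε, z, hzs, hz⟩ := exists_separated_seq_of_not_totallyBounded hnt
  -- Riesz's lemma: in infinite dimension there is a bounded sequence whose terms are pairwise at
  -- distance at least `1`.
  obtain ⟨R, v, hR, hv, hsep⟩ := exists_seq_norm_le_one_le_norm_sub hE
  let _ : NormedSpace ℝ E := NormedSpace.restrictScalars ℝ ℂ E
  obtain ⟨g, hg, hgb⟩ := exists_continuous_of_separated_seq hε hz v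
  refine ⟨BoundedContinuousFunction.ofNormedAddCommGroup (fun x => g (f x))
    (g.continuous.comp f.continuous) R fun x => ?_, fun h => ?_⟩
  · rcases hgb (f x) with h | ⟨n, h⟩
    · rw [h, norm_zero]; linarith
    · exact h.trans (hv n)
  -- With finitely many balls of radius `1 / 2`, two of the `v n` would share a centre and be at
  -- distance less than `1`.
  · obtain ⟨t, ht, hcov⟩ := Metric.totallyBounded_iff.mp h (1 / 2) (by norm_num)
    have hmem : ∀ n, ∃ y ∈ t, dist (v n) y < 1 / 2 := by
      intro n
      obtain ⟨x, hx⟩ := hzs n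
      have := hcov (Set.mem_range_self x)
      obtain ⟨y, hy, hd⟩ := Set.mem_iUnion₂.mp this
      refine ⟨y, hy, ?_⟩
      have e : g (f x) = v n := by rw [hx, hg]
      rw [← e]
      exact hd
    choose y hy hd using hmem
    obtain ⟨m, n, hmn, he⟩ : ∃ m n, m ≠ n ∧ y m = y n := by
      have : Finite t := ht
      obtain ⟨m, n, hmn, he⟩ := Finite.exists_ne_map_eq_of_infinite fun n => (⟨y n, hy n⟩ : t)
      exact ⟨m, n, hmn, congrArg Subtype.val he⟩
    have h1 := hsep hmn
    have h2 := dist_triangle_right (v m) (v n) (y n)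
    have h3 := hd m
    rw [he] at h3
    rw [dist_eq_norm] at h2
    linarith [hd n]

/-- Either hypothesis confines the values of `a` to a compact set, a closed ball or the closure of
the range, and the universal property of `βX` applies. -/
theorem BoundedContinuousFunction.exists_stoneCech_extension {X : Type u} [TopologicalSpace X]
    {E : Type*} [NormedAddCommGroup E] [NormedSpace ℂ E] [CompleteSpace E]
    (h : FiniteDimensional ℂ E ∨ IsPseudocompact X) (a : X →ᵇ E) :
    ∃ g : C(StoneCech X, E), ∀ x, g (stoneCechUnit x) = a x := by
  obtain ⟨K, hK, haK⟩ : ∃ K : Set E, IsCompact K ∧ ∀ x, a x ∈ K := by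
    rcases h with h | h
    · have := FiniteDimensional.proper ℂ E
      exact ⟨Metric.closedBall 0 ‖a‖, isCompact_closedBall _ _, fun x => by
        simpa using a.norm_coe_le_norm x⟩
    · exact ⟨closure (Set.range a), (h.totallyBounded_range a.continuous).closure.isCompact_of_isClosed
        isClosed_closure, fun x => subset_closure (Set.mem_range_self x)⟩
  obtain ⟨g, hg, -⟩ := _root_.exists_stoneCech_extension hK a.continuous haK
  exact ⟨g, hg⟩

/-! ### Fibre norms and induced isomorphisms -/

/-- Two surjective `*`-homomorphisms with the same kernel have isomorphic ranges. -/
theorem exists_starAlgEquiv_of_ker_eq {R B C : Type*}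
    [NonUnitalRing R] [StarRing R] [Module ℂ R]
    [NonUnitalRing B] [StarRing B] [Module ℂ B]
    [NonUnitalRing C] [StarRing C] [Module ℂ C]
    (p : R →⋆ₙₐ[ℂ] B) (q : R →⋆ₙₐ[ℂ] C) (hp : Function.Surjective p)
    (hq : Function.Surjective q) (hker : ∀ r, p r = 0 ↔ q r = 0) :
    ∃ κ : B ≃⋆ₐ[ℂ] C, ∀ r, κ (p r) = q r := by
  have key : ∀ r s, p r = p s ↔ q r = q s := fun r s => by
    rw [← sub_eq_zero, ← map_sub, hker, map_sub, sub_eq_zero]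
  choose σ hσ using hp
  have hqσ : ∀ r, q (σ (p r)) = q r := fun r => (key _ _).mp (hσ _)
  let κ : B →⋆ₙₐ[ℂ] C :=
    { toFun := fun b => q (σ b)
      map_smul' := fun c b => by
        change q (σ (c • b)) = c • q (σ b)
        rw [← map_smul]; exact (key _ _).mp (by rw [map_smul, hσ, hσ])
      map_zero' := by rw [← map_zero q]; exact (key _ _).mp (by rw [hσ, map_zero])
      map_add' := fun b c => by
        rw [← map_add]; exact (key _ _).mp (by rw [map_add, hσ, hσ, hσ])
      map_mul' := fun b c => by
        rw [← map_mul]; exact (key _ _).mp (by rw [map_mul, hσ, hσ, hσ])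
      map_star' := fun b => by
        rw [← map_star]; exact (key _ _).mp (by rw [map_star, hσ, hσ]) }
  refine ⟨StarAlgEquiv.ofBijective κ ⟨fun b c h => ?_, fun c => ?_⟩, fun r => hqσ r⟩
  · have := (key _ _).mpr h
    rwa [hσ, hσ] at this
  · obtain ⟨r, rfl⟩ := hq c
    exact ⟨p r, hqσ r⟩

namespace CZeroAlgebra

variable {X : Type u} {A : Type v} [TopologicalSpace X] [T2Space X] [LocallyCompactSpace X]
  [NonUnitalCStarAlgebra A] (T : CZeroAlgebra X A)

/-- The value map `a ↦ a(x)`, as a `*`-homomorphism. -/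
def valueHom (x : X) : A →⋆ₙₐ[ℂ] T.Fibre x where
  toFun a := T.value a x
  map_smul' c a := map_smul (Fibre.mk T x) c a
  map_zero' := map_zero (Fibre.mk T x)
  map_add' a b := map_add (Fibre.mk T x) a b
  map_mul' a b := Fibre.mk_mul T x a b
  map_star' a := Fibre.mk_star T x a

theorem value_sub (a b : A) (x : X) : T.value (a - b) x = T.value a x - T.value b x :=
  map_sub (Fibre.mk T x) a b

theorem value_eq_zero_iff {a : A} {x : X} : T.value a x = 0 ↔ a ∈ T.J x :=
  Submodule.Quotient.mk_eq_zero (T.J x)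

/-- The norm of `a(x)` is `c`, if `c` is a lower bound of the distances from `a` to `J_x` and is
approximated by the norms of the elements `a - μ(f) a` with `f(x) = 0`. -/
theorem norm_value_eq {a : A} {x : X} {c : ℝ} (h : ∀ j ∈ T.J x, c ≤ ‖a - j‖)
    (h' : ∀ ε > 0, ∃ f : C₀(X, ℂ), f x = 0 ∧ ‖a - (T.μ f).fst a‖ ≤ c + ε) :
    ‖T.value a x‖ = c := by
  refine le_antisymm (le_of_forall_pos_le_add fun ε hε => ?_)
    (le_of_forall_pos_le_add fun ε hε => ?_)
  · obtain ⟨f, hf, hn⟩ := h' ε hε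
    have e : T.value a x = T.value (a - (T.μ f).fst a) x := by
      rw [value_sub, T.value_eq_zero_iff.mpr (T.μ_mem_J hf a), sub_zero]
    rw [e]
    exact (Fibre.norm_mk_le T x _).trans hn
  · obtain ⟨b, hb, hn⟩ := Fibre.norm_mk_lt T x (T.value a x) hε
    have hj : a - b ∈ T.J x := (Fibre.mk_eq_mk T x).mp hb.symm
    have := h _ hj
    rw [sub_sub_cancel] at this
    exact this.trans hn.le

/-- In a continuous `C₀(X)`-algebra a continuous section is determined on a dense set. -/
theorem IsContinuous.section_eq {T : CZeroAlgebra X A} (hT : T.IsContinuous)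
    {D : Set X} (hD : Dense D)
    {s : ∀ x : X, T.Fibre x} (hs : T.IsContinuousSection Set.univ fun x => s x) {a : A}
    (h : ∀ x ∈ D, s x = T.value a x) (x : X) : s x = T.value a x := by
  rw [← sub_eq_zero, ← norm_le_zero_iff]
  refine le_of_forall_pos_le_add fun ε hε => ?_
  obtain ⟨U, hU, b, hb⟩ := hs ⟨x, Set.mem_univ x⟩ (ε / 2) (by positivity)
  have hU' : ∀ᶠ y in 𝓝 x, ‖s y - T.value b y‖ < ε / 2 := by
    rw [nhds_subtype_eq_comap] at hU
    obtain ⟨V, hV, hVU⟩ := hU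
    filter_upwards [hV] with y hy
    exact hb ⟨y, Set.mem_univ y⟩ (hVU hy)
  -- The set where `‖(a - b)(y)‖ > ε / 2` is open by continuity of the algebra. If it contained `x`,
  -- it would contain points of `D` near `x`, where `s = a` and `s` is within `ε / 2` of `b`.
  have hle : ‖T.value (a - b) x‖ ≤ ε / 2 := by
    by_contra hlt
    have h1 := ((hT (a - b)).tendsto x).eventually_const_lt (not_le.mp hlt)
    obtain ⟨O, hO, hOo, hxO⟩ := eventually_nhds_iff.mp (h1.and hU')
    obtain ⟨y, hyO, hyD⟩ := hD.inter_open_nonempty O hOo ⟨x, hxO⟩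
    obtain ⟨h2, h3⟩ := hO y hyO
    rw [h y hyD, ← value_sub] at h3
    linarith
  have e : s x - T.value a x = (s x - T.value b x) - T.value (a - b) x := by
    rw [value_sub]; abel
  rw [e]
  linarith [norm_sub_le (s x - T.value b x) (T.value (a - b) x), hU'.self_of_nhds]

end CZeroAlgebra

/-! ### Functions in `C₀(X, B)` and bounded functions as multipliers -/

namespace TrivialCZeroAlgebra

variable {X : Type u} {B : Type v} [TopologicalSpace X] [NonUnitalCStarAlgebra B]

theorem eq_of_subsingleton [Subsingleton B] (a b : X →ᵇ B) : a = b :=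
  BoundedContinuousFunction.ext fun _ => Subsingleton.elim _ _

theorem norm_apply_le (F : C₀(X, B)) (x : X) : ‖F x‖ ≤ ‖F‖ := by
  rw [← ZeroAtInftyContinuousMap.norm_toBCF_eq_norm]
  exact F.toBCF.norm_coe_le_norm x

theorem norm_le_of_forall {F : C₀(X, B)} {c : ℝ} (hc : 0 ≤ c) (h : ∀ x, ‖F x‖ ≤ c) :
    ‖F‖ ≤ c := by
  rw [← ZeroAtInftyContinuousMap.norm_toBCF_eq_norm]
  exact (BoundedContinuousFunction.norm_le hc).mpr h

/-- The norm bound lets pointwise estimates be read off from operator norms of multipliers. -/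
theorem exists_apply_eq [T2Space X] [LocallyCompactSpace X] (x : X) (b : B) :
    ∃ F : C₀(X, B), F x = b ∧ ‖F‖ ≤ ‖b‖ := by
  obtain ⟨f, hf1, -, hfc, hf⟩ := exists_continuous_one_zero_of_isCompact
    (isCompact_singleton (x := x)) isClosed_empty (Set.disjoint_empty _)
  have hfc' : HasCompactSupport fun y => (f y : ℂ) • b :=
    hfc.mono fun y hy hy' => hy (by simp [hy'])
  refine ⟨⟨⟨fun y => (f y : ℂ) • b, by fun_prop⟩, hfc'.is_zero_at_infty⟩, ?_,
    norm_le_of_forall (norm_nonneg b) fun y => ?_⟩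
  · change (f x : ℂ) • b = b
    rw [hf1 (Set.mem_singleton x)]
    simp
  · change ‖(f y : ℂ) • b‖ ≤ ‖b‖
    rw [norm_smul, Complex.norm_real, Real.norm_of_nonneg (hf y).1]
    exact mul_le_of_le_one_left (norm_nonneg b) (hf y).2

/-! ### Cutting off by the norm. -/

/-- The cutoff function `t ↦ (t - c)⁺ / (t + ε)`. -/
def cutoff (c ε t : ℝ) : ℝ := max (t - c) 0 / (t + ε)

theorem cutoff_self (c ε : ℝ) : cutoff c ε c = 0 := by simp [cutoff]

theorem cutoff_zero {c : ℝ} (hc : 0 ≤ c) (ε : ℝ) : cutoff c ε 0 = 0 := by simp [cutoff, hc]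

theorem continuousOn_cutoff (c : ℝ) {ε : ℝ} (hε : 0 < ε) :
    ContinuousOn (cutoff c ε) (Set.Ici 0) := by
  unfold cutoff
  refine ContinuousOn.div (by fun_prop) (by fun_prop) fun t ht => ?_
  have : (0 : ℝ) ≤ t := ht
  positivity

/-- With `t = ‖b‖`, the factor `1 - cutoff c ε t` is `1` for `t ≤ c` and `(c + ε) / (t + ε)` for `t
≥ c`. The `ε` in the denominator keeps the cutoff continuous at `t = 0` when `c = 0`. -/
theorem norm_sub_cutoff_smul_le {c ε : ℝ} (hc : 0 ≤ c) (hε : 0 < ε) (b : B) :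
    ‖b - ((cutoff c ε ‖b‖ : ℝ) : ℂ) • b‖ ≤ c + ε := by
  have e : b - ((cutoff c ε ‖b‖ : ℝ) : ℂ) • b = ((1 - cutoff c ε ‖b‖ : ℝ) : ℂ) • b := by
    rw [Complex.ofReal_sub, Complex.ofReal_one, sub_smul, one_smul]
  have ht := norm_nonneg b
  rw [e, norm_smul, Complex.norm_real]
  generalize ‖b‖ = t at ht
  have hp : 0 < t + ε := by positivity
  rcases le_total t c with h | h
  · have : cutoff c ε t = 0 := by rw [cutoff, max_eq_right (by linarith), zero_div]
    rw [this, sub_zero, norm_one, one_mul]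
    linarith
  · have : 1 - cutoff c ε t = (c + ε) / (t + ε) := by
      rw [cutoff, max_eq_left (by linarith)]
      field_simp
      ring
    rw [this, Real.norm_of_nonneg (by positivity), div_mul_eq_mul_div, div_le_iff₀ hp]
    nlinarith

/-- The cutoff is composed with `‖F‖`, with threshold `c = ‖F x‖`. It vanishes at `x` because
`cutoff c ε c = 0` and at infinity because `cutoff c ε 0 = 0`. -/
theorem exists_cutoff (F : C₀(X, B)) (x : X) {ε : ℝ} (hε : 0 < ε) :
    ∃ f : C₀(X, ℂ), f x = 0 ∧ ‖F - smulFun f F‖ ≤ ‖F x‖ + ε := by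
  have hcont := (continuousOn_cutoff ‖F x‖ hε).comp_continuous (map_continuous F).norm
    fun y => norm_nonneg (F y)
  have hz : Tendsto (fun y => cutoff ‖F x‖ ε ‖F y‖) (cocompact X) (𝓝 0) := by
    have h1 : Tendsto (fun y => ‖F y‖) (cocompact X) (𝓝[Set.Ici 0] 0) :=
      tendsto_nhdsWithin_iff.mpr ⟨by simpa using (zero_at_infty F).norm,
        Eventually.of_forall fun y => norm_nonneg (F y)⟩
    have h2 := continuousOn_cutoff ‖F x‖ hε 0 (Set.self_mem_Ici)
    rw [ContinuousWithinAt, cutoff_zero (norm_nonneg (F x))] at h2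
    exact h2.comp h1
  refine ⟨⟨⟨fun y => ((cutoff ‖F x‖ ε ‖F y‖ : ℝ) : ℂ), Complex.continuous_ofReal.comp hcont⟩, ?_⟩,
    ?_, norm_le_of_forall (by positivity) fun y => norm_sub_cutoff_smul_le (norm_nonneg _) hε _⟩
  · simpa using! (Complex.continuous_ofReal.tendsto 0).comp hz
  · change ((cutoff ‖F x‖ ε ‖F x‖ : ℝ) : ℂ) = 0
    rw [cutoff_self, Complex.ofReal_zero]

/-! ### Norm functions extended to `βX`. -/

/-- The continuous extension to `βX` of the norm function of a bounded continuous function. -/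
def normExt (a : X →ᵇ B) : C(StoneCech X, ℝ) :=
  (exists_stoneCech_extension (isCompact_Icc (a := 0) (b := ‖a‖)) a.continuous.norm
    fun x => ⟨norm_nonneg _, a.norm_coe_le_norm x⟩).choose

theorem normExt_unit (a : X →ᵇ B) (x : X) : normExt a (stoneCechUnit x) = ‖a x‖ :=
  (exists_stoneCech_extension (isCompact_Icc (a := 0) (b := ‖a‖)) a.continuous.norm
    fun x => ⟨norm_nonneg _, a.norm_coe_le_norm x⟩).choose_spec.1 x

/-- This and the following relations hold on `X` and pass to `βX` by density. They make `normExt ·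
y` a seminorm dominated by the supremum norm, in the end the fibre norm at `y`. -/
theorem normExt_nonneg (a : X →ᵇ B) (y : StoneCech X) : 0 ≤ normExt a y :=
  stoneCech_induction (isClosed_le continuous_const (normExt a).continuous)
    (fun x => by rw [normExt_unit]; exact norm_nonneg _) y

theorem normExt_le (a : X →ᵇ B) (y : StoneCech X) : normExt a y ≤ ‖a‖ :=
  stoneCech_induction (isClosed_le (normExt a).continuous continuous_const)
    (fun x => by rw [normExt_unit]; exact a.norm_coe_le_norm x) y

theorem normExt_add_le (a b : X →ᵇ B) (y : StoneCech X) :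
    normExt (a + b) y ≤ normExt a y + normExt b y :=
  stoneCech_induction (isClosed_le (normExt _).continuous
    ((normExt a).continuous.add (normExt b).continuous))
    (fun x => by
      change normExt (a + b) _ ≤ normExt a _ + normExt b _
      rw [normExt_unit, normExt_unit, normExt_unit]
      exact norm_add_le (a x) (b x)) y

theorem normExt_smul (c : ℂ) (a : X →ᵇ B) (y : StoneCech X) :
    normExt (c • a) y = ‖c‖ * normExt a y :=
  stoneCech_induction (isClosed_eq (normExt _).continuous
    (continuous_const.mul (normExt a).continuous))
    (fun x => by
      change normExt (c • a) _ = ‖c‖ * normExt a _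
      rw [normExt_unit, normExt_unit]
      exact norm_smul c (a x)) y

/-- The pointwise product of a continuous function on `βX` and a bounded continuous function. -/
def extSMul (u : C₀(StoneCech X, ℂ)) (a : X →ᵇ B) : X →ᵇ B :=
  BoundedContinuousFunction.ofNormedAddCommGroup (fun x => u (stoneCechUnit x) • a x)
    (((map_continuous u).comp continuous_stoneCechUnit).smul a.continuous) (‖u.toBCF‖ * ‖a‖)
    fun x => by
      rw [norm_smul]
      exact mul_le_mul (u.toBCF.norm_coe_le_norm _) (a.norm_coe_le_norm x) (norm_nonneg _)
        (norm_nonneg _)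

theorem normExt_extSMul (u : C₀(StoneCech X, ℂ)) (a : X →ᵇ B) (y : StoneCech X) :
    normExt (extSMul u a) y = ‖u y‖ * normExt a y :=
  stoneCech_induction (isClosed_eq (normExt _).continuous
    ((map_continuous u).norm.mul (normExt a).continuous))
    (fun x => by
      change normExt (extSMul u a) _ = ‖u _‖ * normExt a _
      rw [normExt_unit, normExt_unit]
      exact norm_smul (u _) (a x)) y

/-- The threshold is now `normExt a y`, with `y` possibly outside `X`. The supremum norm is tested
on `X` only, where `normExt a` is the norm of `a`. -/
theorem exists_cutoff_ext (a : X →ᵇ B) (y : StoneCech X) {ε : ℝ} (hε : 0 < ε) :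
    ∃ u : C₀(StoneCech X, ℂ), u y = 0 ∧ ‖a - extSMul u a‖ ≤ normExt a y + ε := by
  have hcont := (continuousOn_cutoff (normExt a y) hε).comp_continuous (normExt a).continuous
    fun z => normExt_nonneg a z
  refine ⟨⟨⟨fun z => ((cutoff (normExt a y) ε (normExt a z) : ℝ) : ℂ),
    Complex.continuous_ofReal.comp hcont⟩, by simp⟩, ?_, ?_⟩
  · change ((cutoff (normExt a y) ε (normExt a y) : ℝ) : ℂ) = 0
    rw [cutoff_self, Complex.ofReal_zero]
  · have h0 := normExt_nonneg a y
    refine (BoundedContinuousFunction.norm_le (by positivity)).mpr fun x => ?_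
    change ‖a x - ((cutoff (normExt a y) ε (normExt a (stoneCechUnit x)) : ℝ) : ℂ) • a x‖ ≤ _
    rw [normExt_unit]
    exact norm_sub_cutoff_smul_le h0 hε _

/-! ### Bounded functions acting as multipliers. -/

/-- The pointwise product of a bounded continuous function and a function in `C₀(X, B)`. -/
def mulLeft (a : X →ᵇ B) (F : C₀(X, B)) : C₀(X, B) where
  toFun x := a x * F x
  continuous_toFun := a.continuous.mul (map_continuous F)
  zero_at_infty' := by
    have h : Tendsto (fun x => ‖a‖ * ‖F x‖) (cocompact X) (𝓝 0) := by
      simpa using (zero_at_infty F).norm.const_mul ‖a‖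
    refine squeeze_zero_norm (fun x => (norm_mul_le _ _).trans ?_) h
    exact mul_le_mul_of_nonneg_right (a.norm_coe_le_norm x) (norm_nonneg _)

/-- The pointwise product of a function in `C₀(X, B)` and a bounded continuous function. -/
def mulRight (a : X →ᵇ B) (F : C₀(X, B)) : C₀(X, B) where
  toFun x := F x * a x
  continuous_toFun := (map_continuous F).mul a.continuous
  zero_at_infty' := by
    have h : Tendsto (fun x => ‖F x‖ * ‖a‖) (cocompact X) (𝓝 0) := by
      simpa using (zero_at_infty F).norm.mul_const ‖a‖
    refine squeeze_zero_norm (fun x => (norm_mul_le _ _).trans ?_) h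
    exact mul_le_mul_of_nonneg_left (a.norm_coe_le_norm x) (norm_nonneg _)

/-- A bounded continuous function as a multiplier of `C₀(X, B)`. -/
def bddMultiplier (a : X →ᵇ B) : 𝓜(ℂ, C₀(X, B)) where
  fst := LinearMap.mkContinuous
    { toFun := mulLeft a
      map_add' := fun F G => by ext x; exact mul_add (a x) (F x) (G x)
      map_smul' := fun c F => by ext x; exact mul_smul_comm c (a x) (F x) }
    ‖a‖ fun F => norm_le_of_forall (by positivity) fun x => (norm_mul_le _ _).trans
      (mul_le_mul (a.norm_coe_le_norm x) (norm_apply_le F x) (norm_nonneg _) (norm_nonneg _))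
  snd := LinearMap.mkContinuous
    { toFun := mulRight a
      map_add' := fun F G => by ext x; exact add_mul (F x) (G x) (a x)
      map_smul' := fun c F => by ext x; exact smul_mul_assoc c (F x) (a x) }
    ‖a‖ fun F => norm_le_of_forall (by positivity) fun x =>
      ((norm_mul_le _ _).trans (mul_le_mul (norm_apply_le F x) (a.norm_coe_le_norm x)
        (norm_nonneg _) (norm_nonneg _))).trans_eq (mul_comm _ _)
  central F G := by ext x; exact mul_assoc (F x) (a x) (G x)

theorem bddMultiplier_apply (a : X →ᵇ B) (F : C₀(X, B)) (x : X) :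
    (bddMultiplier a).fst F x = a x * F x := rfl

theorem norm_bddMultiplier_le (a : X →ᵇ B) : ‖bddMultiplier a‖ ≤ ‖a‖ := by
  rw [← DoubleCentralizer.norm_fst]
  exact ContinuousLinearMap.opNorm_le_bound _ (norm_nonneg a) fun F =>
    norm_le_of_forall (by positivity) fun x => (norm_mul_le _ _).trans
      (mul_le_mul (a.norm_coe_le_norm x) (norm_apply_le F x) (norm_nonneg _) (norm_nonneg _))

variable (X B) in
/-- The `*`-homomorphism from `Cᵇ(X, B)` to the multiplier algebra of `C₀(X, B)`. -/
def bddMultiplierHom : (X →ᵇ B) →⋆ₙₐ[ℂ] 𝓜(ℂ, C₀(X, B)) where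
  toFun := bddMultiplier
  map_smul' c a := MultiplierAux.ext_fst fun F => by
    ext x; exact smul_mul_assoc c (a x) (F x)
  map_zero' := MultiplierAux.ext_fst fun F => by
    ext x; exact zero_mul (F x)
  map_add' a b := MultiplierAux.ext_fst fun F => by
    ext x; exact add_mul (a x) (b x) (F x)
  map_mul' a b := MultiplierAux.ext_fst fun F => by
    ext x; exact mul_assoc (a x) (b x) (F x)
  map_star' a := MultiplierAux.ext_fst fun F => by
    ext x
    change star (a x) * F x = star (star (F x) * a x)
    rw [star_mul, star_star]

theorem bddMultiplier_sub (a b : X →ᵇ B) :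
    bddMultiplier (a - b) = bddMultiplier a - bddMultiplier b := map_sub (bddMultiplierHom X B) a b

theorem bddMultiplier_toBCF (F : C₀(X, B)) : bddMultiplier F.toBCF = (F : 𝓜(ℂ, C₀(X, B))) :=
  MultiplierAux.ext_fst fun G => by ext x; rfl

variable (X B) in
/-- Evaluation at a point, as a `*`-homomorphism. -/
def evalHom (x : X) : C₀(X, B) →⋆ₙₐ[ℂ] B where
  toFun F := F x
  map_smul' _ _ := rfl
  map_zero' := rfl
  map_add' _ _ := rfl
  map_mul' _ _ := rfl
  map_star' _ := rfl

theorem continuous_eval (x : X) : Continuous fun F : C₀(X, B) => F x :=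
  (AddMonoidHomClass.lipschitz_of_bound (evalHom X B x) 1 fun F => by
    rw [one_mul]; exact norm_apply_le F x).continuous

variable (X B) in
/-- Restriction of functions from `βX` to `X`, as a `*`-homomorphism. -/
def restrictHom : C(StoneCech X, B) →⋆ₙₐ[ℂ] (X →ᵇ B) where
  toFun g := (BoundedContinuousFunction.mkOfCompact g).compContinuous
    ⟨stoneCechUnit, continuous_stoneCechUnit⟩
  map_smul' _ _ := rfl
  map_zero' := rfl
  map_add' _ _ := rfl
  map_mul' _ _ := rfl
  map_star' _ := rfl

theorem restrictHom_injective : Function.Injective (restrictHom X B) := fun g h e =>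
  ContinuousMap.ext fun y => stoneCech_induction (isClosed_eq g.continuous h.continuous)
    (fun x => DFunLike.congr_fun e x) y

end TrivialCZeroAlgebra

/-! ### The trivial `C₀(X)`-algebra: fibres and bounded sections -/

namespace TrivialCZeroAlgebra

variable {X : Type u} {B : Type v} [TopologicalSpace X] [T2Space X] [LocallyCompactSpace X]
  [NonUnitalCStarAlgebra B]

theorem evalHom_surjective (x : X) : Function.Surjective (evalHom X B x) := fun b => by
  obtain ⟨F, hF, -⟩ := exists_apply_eq x b
  exact ⟨F, hF⟩

theorem apply_eq_zero_of_mem_J {x : X} {F : C₀(X, B)} (hF : F ∈ (trivialCZeroAlgebra X B).J x) :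
    F x = 0 := by
  refine (trivialCZeroAlgebra X B).J_induction x (p := fun F => F x = 0)
    (isClosed_eq (continuous_eval x) continuous_const) ?_ rfl ?_ ?_ hF
  · intro f F hf
    change f x • F x = 0
    rw [hf, zero_smul]
  · intro F G hF hG
    change F x + G x = 0
    rw [hF, hG, add_zero]
  · intro c F hF
    change c • F x = 0
    rw [hF, smul_zero]

/-- Lower bound: subtracting an element of `J_x` does not change the value at `x`. Upper bound: the
cutoff. -/
theorem norm_value (F : C₀(X, B)) (x : X) : ‖(trivialCZeroAlgebra X B).value F x‖ = ‖F x‖ := by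
  refine (trivialCZeroAlgebra X B).norm_value_eq (fun G hG => ?_) fun ε hε => exists_cutoff F x hε
  have h := norm_apply_le (F - G) x
  have e : (F - G) x = F x - G x := rfl
  rwa [e, apply_eq_zero_of_mem_J hG, sub_zero] at h

theorem value_eq_zero_iff (F : C₀(X, B)) (x : X) :
    (trivialCZeroAlgebra X B).value F x = 0 ↔ F x = 0 := by
  rw [← norm_eq_zero, norm_value, norm_eq_zero]

variable (X B) in
theorem exists_fibreEquiv (x : X) : ∃ ι : B ≃⋆ₐ[ℂ] (trivialCZeroAlgebra X B).Fibre x,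
    ∀ F : C₀(X, B), ι (F x) = (trivialCZeroAlgebra X B).value F x :=
  exists_starAlgEquiv_of_ker_eq (evalHom X B x) ((trivialCZeroAlgebra X B).valueHom x)
    (evalHom_surjective x) (CZeroAlgebra.Fibre.mk_surjective _ x)
    fun F => (value_eq_zero_iff F x).symm

variable (X B) in
/-- The canonical isomorphism of `B` with the fibre at `x`. -/
def fibreEquiv (x : X) : B ≃⋆ₐ[ℂ] (trivialCZeroAlgebra X B).Fibre x :=
  (exists_fibreEquiv X B x).choose

theorem fibreEquiv_apply (x : X) (F : C₀(X, B)) :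
    fibreEquiv X B x (F x) = (trivialCZeroAlgebra X B).value F x :=
  (exists_fibreEquiv X B x).choose_spec F

theorem norm_fibreEquiv (x : X) (b : B) : ‖fibreEquiv X B x b‖ = ‖b‖ := by
  obtain ⟨F, rfl, -⟩ := exists_apply_eq x b
  rw [fibreEquiv_apply, norm_value]

theorem norm_fibreEquiv_sub_value (x : X) (b : B) (F : C₀(X, B)) :
    ‖fibreEquiv X B x b - (trivialCZeroAlgebra X B).value F x‖ = ‖b - F x‖ := by
  rw [← fibreEquiv_apply, ← map_sub, norm_fibreEquiv]

variable (X B) in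
theorem support_eq_univ [Nontrivial B] : (trivialCZeroAlgebra X B).support = Set.univ := by
  refine Set.eq_univ_of_forall fun x hx => ?_
  obtain ⟨b, hb⟩ := exists_ne (0 : B)
  obtain ⟨F, rfl, -⟩ := exists_apply_eq x b
  exact hb (apply_eq_zero_of_mem_J (hx ▸ Submodule.mem_top))

variable (X B) in
theorem isEmpty_support [Subsingleton B] : IsEmpty (trivialCZeroAlgebra X B).support := by
  refine ⟨fun x => x.2 (eq_top_iff.mpr fun F _ => ?_)⟩
  rw [← CZeroAlgebra.value_eq_zero_iff, value_eq_zero_iff]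
  exact Subsingleton.elim _ _

variable (X B) in
theorem mem_support [Nontrivial B] (x : X) : x ∈ (trivialCZeroAlgebra X B).support := by
  rw [support_eq_univ]; exact Set.mem_univ x

variable (X B) in
/-- The `*`-homomorphism from `Cᵇ(X, B)` to the bounded continuous sections. -/
def sectionHom : (X →ᵇ B) →⋆ₙₐ[ℂ] (trivialCZeroAlgebra X B).boundedSections where
  toFun a := ⟨fun x => fibreEquiv X B x (a x), by
    refine ⟨fun x ε hε => ?_, ‖a‖, fun x => ?_⟩
    · obtain ⟨F, hF, -⟩ := exists_apply_eq (x : X) (a x)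
      have hc : Continuous fun y : (trivialCZeroAlgebra X B).support => ‖a y - F y‖ :=
        ((a.continuous.sub (map_continuous F)).norm).comp continuous_subtype_val
      have h := (hc.tendsto x).eventually_lt_const (show ‖a x - F x‖ < ε by rw [hF]; simpa)
      exact ⟨_, h, F, fun y hy => by rw [norm_fibreEquiv_sub_value]; exact hy⟩
    · rw [norm_fibreEquiv]; exact a.norm_coe_le_norm x⟩
  map_smul' c a := Subtype.ext (funext fun x => map_smul (fibreEquiv X B x) c (a x))
  map_zero' := Subtype.ext (funext fun x => map_zero (fibreEquiv X B x))
  map_add' a b := Subtype.ext (funext fun x => map_add (fibreEquiv X B x) (a x) (b x))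
  map_mul' a b := Subtype.ext (funext fun x => map_mul (fibreEquiv X B x) (a x) (b x))
  map_star' a := Subtype.ext (funext fun x => map_star (fibreEquiv X B x) (a x))

theorem sectionHom_apply (a : X →ᵇ B) (x : (trivialCZeroAlgebra X B).support) :
    (sectionHom X B a : ∀ x : (trivialCZeroAlgebra X B).support,
      (trivialCZeroAlgebra X B).Fibre (x : X)) x = fibreEquiv X B x (a x) := rfl

theorem sectionHom_bijective : Function.Bijective (sectionHom X B) := by
  -- If `B = 0` all fibres vanish and sections live over the empty set; otherwise the support is all
  -- of `X`.
  rcases subsingleton_or_nontrivial B with hB | hB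
  · have := isEmpty_support X B
    exact ⟨fun a b _ => eq_of_subsingleton a b,
      fun s => ⟨0, Subtype.ext (funext fun x => isEmptyElim x)⟩⟩
  refine ⟨fun a b h => BoundedContinuousFunction.ext fun x => ?_, ?_⟩
  · have h1 := congrFun (congrArg Subtype.val h) ⟨x, mem_support X B x⟩
    exact (fibreEquiv X B x).injective h1
  · rintro ⟨s, hs, C, hC⟩
    let f : X → B := fun x => (fibreEquiv X B x).symm (s ⟨x, mem_support X B x⟩)
    have hf : ∀ x, fibreEquiv X B x (f x) = s ⟨x, mem_support X B x⟩ := fun x =>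
      (fibreEquiv X B x).apply_symm_apply _
    have hcont : Continuous f := by
      refine continuous_iff_continuousAt.mpr fun x => Metric.tendsto_nhds.mpr fun ε hε => ?_
      obtain ⟨U, hU, F, hF⟩ := hs ⟨x, mem_support X B x⟩ (ε / 3) (by positivity)
      have hU' : ∀ᶠ y in 𝓝 x, ‖f y - F y‖ < ε / 3 := by
        rw [nhds_subtype_eq_comap] at hU
        obtain ⟨V, hV, hVU⟩ := hU
        filter_upwards [hV] with y hy
        rw [← norm_fibreEquiv_sub_value, hf]
        exact hF ⟨y, mem_support X B y⟩ (hVU hy)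
      have hFc := Metric.tendsto_nhds.mp ((map_continuous F).tendsto x) (ε / 3) (by positivity)
      filter_upwards [hU', hFc] with y h1 h2
      have h3 := hU'.self_of_nhds
      rw [← dist_eq_norm] at h1 h3
      linarith [dist_triangle4_right (f y) (f x) (F y) (F x)]
    refine ⟨BoundedContinuousFunction.ofNormedAddCommGroup f hcont C fun x => ?_,
      Subtype.ext (funext fun x => hf x)⟩
    rw [← norm_fibreEquiv x, hf]
    exact hC _

theorem iSup_norm_sectionHom (a : X →ᵇ B) : ⨆ x : (trivialCZeroAlgebra X B).support,
    ‖(sectionHom X B a : ∀ x : (trivialCZeroAlgebra X B).support,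
      (trivialCZeroAlgebra X B).Fibre (x : X)) x‖ = ‖a‖ := by
  simp only [sectionHom_apply, norm_fibreEquiv]
  rcases subsingleton_or_nontrivial B with hB | hB
  · have := isEmpty_support X B
    -- The supremum over the empty support is `0` by convention, which is the norm of the only
    -- element.
    rw [Real.iSup_of_isEmpty, eq_of_subsingleton a 0, norm_zero]
  · rw [BoundedContinuousFunction.norm_eq_iSup_norm]
    exact (Equiv.subtypeUnivEquiv (mem_support X B)).iSup_congr fun _ => rfl

/-! ### The trivial `C₀(X)`-algebra: the algebra `A^β` -/

variable (X B) in
-- The action of `u` is known only through its products with `g ∈ C₀(X)`; a `g` with `g x = 1`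
-- reveals its value at `x`.
theorem μExt_fst_apply (u : C₀(StoneCech X, ℂ)) (F : C₀(X, B)) (x : X) :
    ((trivialCZeroAlgebra X B).μExt u).fst F x = u (stoneCechUnit x) • F x := by
  obtain ⟨g, hg, -⟩ := exists_apply_eq (B := ℂ) x 1
  have h := DFunLike.congr_fun ((trivialCZeroAlgebra X B).μ_extCLM u F g) x
  change g x • ((trivialCZeroAlgebra X B).μExt u).fst F x = (u (stoneCechUnit x) * g x) • F x at h
  rwa [hg, one_smul, mul_one] at h

theorem μExt_mul_bddMultiplier (u : C₀(StoneCech X, ℂ)) (a : X →ᵇ B) :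
    (trivialCZeroAlgebra X B).μExt u * bddMultiplier a = bddMultiplier (extSMul u a) :=
  MultiplierAux.ext_fst fun F => by
    ext x
    change ((trivialCZeroAlgebra X B).μExt u).fst (mulLeft a F) x = (u _ • a x) * F x
    rw [μExt_fst_apply, smul_mul_assoc]
    rfl

/-- Since `normExt a` vanishes at `x`, the cutoff approximates `a` by products `u a` with `u` zero
at `x`, and `H_x` is closed. -/
theorem bddMultiplier_mem_H {a : X →ᵇ B} {x : X} (ha : a x = 0) :
    bddMultiplier a ∈ (trivialCZeroAlgebra X B).H (stoneCechUnit x) := by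
  refine ((trivialCZeroAlgebra X B).multiplierAlgebra.isClosed_J (stoneCechUnit x)).closure_subset
    (Metric.mem_closure_iff.mpr fun ε hε => ?_)
  obtain ⟨u, hu, hn⟩ := exists_cutoff_ext a (stoneCechUnit x) (half_pos hε)
  rw [normExt_unit, ha, norm_zero, zero_add] at hn
  refine ⟨bddMultiplier (extSMul u a), ?_, ?_⟩
  · rw [← μExt_mul_bddMultiplier]
    exact (trivialCZeroAlgebra X B).multiplierAlgebra.μ_mem_J hu (bddMultiplier a)
  · rw [dist_eq_norm, ← bddMultiplier_sub]
    linarith [norm_bddMultiplier_le (a - extSMul u a)]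

theorem bddMultiplier_mem_beta (a : X →ᵇ B) :
    bddMultiplier a ∈ (trivialCZeroAlgebra X B).beta := by
  intro x _
  obtain ⟨F, hF, -⟩ := exists_apply_eq x (a x)
  refine ⟨F, ?_⟩
  rw [← bddMultiplier_toBCF, ← bddMultiplier_sub]
  refine bddMultiplier_mem_H ?_
  change a x - F x = 0
  rw [hF, sub_self]

/-- Near `x` the multipliers in `H_x` are small. -/
theorem eventually_norm_le_of_mem_H {x : X} {m : 𝓜(ℂ, C₀(X, B))}
    (hm : m ∈ (trivialCZeroAlgebra X B).H (stoneCechUnit x)) :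
    ∀ ε > 0, ∀ᶠ y in 𝓝 x, ∀ G : C₀(X, B), ‖m.fst G y‖ ≤ ε * ‖G‖ := by
  -- The neighbourhood must not depend on `G`, since later `G` is chosen after the point `y`. A
  -- generator `μ(u) m` acts at `y` with norm at most `‖u y‖ ‖m‖`, which is small near `x`.
  refine (trivialCZeroAlgebra X B).multiplierAlgebra.J_induction (stoneCechUnit x)
    (p := fun m => ∀ ε > 0, ∀ᶠ y in 𝓝 x, ∀ G : C₀(X, B), ‖m.fst G y‖ ≤ ε * ‖G‖)
    (isClosed_of_closure_subset fun m hm ε hε => ?_) ?_ ?_ ?_ ?_ hm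
  · obtain ⟨n, hn, hd⟩ := Metric.mem_closure_iff.mp hm (ε / 2) (by positivity)
    filter_upwards [hn (ε / 2) (by positivity)] with y hy G
    have e : m.fst G y = (m - n).fst G y + n.fst G y := by
      change m.fst G y = (m.fst G y - n.fst G y) + n.fst G y
      rw [sub_add_cancel]
    have h1 : ‖(m - n).fst G y‖ ≤ ε / 2 * ‖G‖ := by
      refine (norm_apply_le _ _).trans (((m - n).fst.le_opNorm G).trans ?_)
      rw [DoubleCentralizer.norm_fst, ← dist_eq_norm]
      exact mul_le_mul_of_nonneg_right hd.le (norm_nonneg _)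
    rw [e]
    linarith [norm_add_le ((m - n).fst G y) (n.fst G y), hy G]
  · intro u m hu ε hε
    have hc : Continuous fun y : X => ‖u (stoneCechUnit y)‖ * ‖m‖ :=
      ((map_continuous u).comp continuous_stoneCechUnit).norm.mul continuous_const
    filter_upwards [(hc.tendsto x).eventually_lt_const
      (show ‖u (stoneCechUnit x)‖ * ‖m‖ < ε by simpa [hu])] with y hy G
    change ‖((trivialCZeroAlgebra X B).μExt u).fst (m.fst G) y‖ ≤ _
    rw [μExt_fst_apply, norm_smul]
    have h1 : ‖m.fst G y‖ ≤ ‖m‖ * ‖G‖ := by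
      refine (norm_apply_le _ _).trans ((m.fst.le_opNorm G).trans ?_)
      rw [DoubleCentralizer.norm_fst]
    calc ‖u (stoneCechUnit y)‖ * ‖m.fst G y‖ ≤ ‖u (stoneCechUnit y)‖ * (‖m‖ * ‖G‖) := by gcongr
      _ = ‖u (stoneCechUnit y)‖ * ‖m‖ * ‖G‖ := by ring
      _ ≤ ε * ‖G‖ := by gcongr
  · intro ε hε
    refine Eventually.of_forall fun y G => ?_
    change ‖(0 : B)‖ ≤ _
    rw [norm_zero]; positivity
  · intro m n hm hn ε hε
    filter_upwards [hm (ε / 2) (by positivity), hn (ε / 2) (by positivity)] with y h1 h2 G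
    change ‖m.fst G y + n.fst G y‖ ≤ _
    linarith [norm_add_le (m.fst G y) (n.fst G y), h1 G, h2 G]
  · intro c m hm ε hε
    filter_upwards [hm (ε / (‖c‖ + 1)) (by positivity)] with y h1 G
    change ‖c • m.fst G y‖ ≤ _
    rw [norm_smul]
    calc ‖c‖ * ‖m.fst G y‖ ≤ (‖c‖ + 1) * (ε / (‖c‖ + 1) * ‖G‖) := by
          gcongr
          · linarith
          · exact h1 G
      _ = ε * ‖G‖ := by field_simp

/-- Testing on `d = star b` suffices, by the C*-identity; no unit is needed. -/
theorem norm_le_of_forall_mul {b : B} {c : ℝ} (hc : 0 ≤ c) (h : ∀ d : B, ‖b * d‖ ≤ c * ‖d‖) :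
    ‖b‖ ≤ c := by
  have h1 := h (star b)
  rw [CStarRing.norm_self_mul_star, norm_star] at h1
  rcases (norm_nonneg b).eq_or_lt with h0 | h0
  · rwa [← h0]
  · exact le_of_mul_le_mul_right h1 h0

/-- Choose `F x ∈ A` with `m - F x ∈ H_x`. At `x` itself the estimate holds for all `ε`, so `m`
multiplies by `f x = F x x`. Near `x` it says that `f` is uniformly close to the continuous function
`F x`, so `f` is continuous at `x`. -/
theorem exists_bddMultiplier_eq {m : 𝓜(ℂ, C₀(X, B))} (hm : m ∈ (trivialCZeroAlgebra X B).beta) :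
    ∃ a : X →ᵇ B, bddMultiplier a = m := by
  rcases subsingleton_or_nontrivial B with hB | hB
  · exact ⟨0, MultiplierAux.ext_fst fun F => by ext x; exact Subsingleton.elim _ _⟩
  choose F hF using fun x => hm x (mem_support X B x)
  have hloc : ∀ x, ∀ ε > 0, ∀ᶠ y in 𝓝 x, ∀ G : C₀(X, B),
      ‖m.fst G y - F x y * G y‖ ≤ ε * ‖G‖ := fun x => eventually_norm_le_of_mem_H (hF x)
  let f : X → B := fun x => F x x
  have hf : ∀ (G : C₀(X, B)) x, m.fst G x = f x * G x := by
    intro G x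
    rw [← sub_eq_zero, ← norm_le_zero_iff]
    refine le_of_forall_pos_le_add fun ε hε => ?_
    have h1 := (hloc x (ε / (‖G‖ + 1)) (by positivity)).self_of_nhds G
    refine h1.trans ?_
    rw [zero_add, div_mul_eq_mul_div, div_le_iff₀ (by positivity)]
    nlinarith [norm_nonneg G]
  have hcont : Continuous f := by
    refine continuous_iff_continuousAt.mpr fun x => Metric.tendsto_nhds.mpr fun ε hε => ?_
    have hFc := Metric.tendsto_nhds.mp ((map_continuous (F x)).tendsto x) (ε / 2) (by positivity)
    filter_upwards [hloc x (ε / 3) (by positivity), hFc] with y h1 h2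
    have h3 : ‖f y - F x y‖ ≤ ε / 3 := norm_le_of_forall_mul (by positivity) fun d => by
      obtain ⟨G, hG, hGn⟩ := exists_apply_eq y d
      have h4 := h1 G
      rw [hf, ← sub_mul, hG] at h4
      exact h4.trans (mul_le_mul_of_nonneg_left hGn (by positivity))
    rw [← dist_eq_norm] at h3
    have h5 : dist (F x y) (f x) < ε / 2 := h2
    linarith [dist_triangle (f y) (F x y) (f x)]
  refine ⟨BoundedContinuousFunction.ofNormedAddCommGroup f hcont ‖m‖ fun x =>
    norm_le_of_forall_mul (norm_nonneg _) fun d => ?_,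
    MultiplierAux.ext_fst fun G => by ext x; exact (hf G x).symm⟩
  obtain ⟨G, hG, hGn⟩ := exists_apply_eq x d
  rw [← hG, ← hf, hG]
  refine (norm_apply_le _ _).trans ((m.fst.le_opNorm G).trans ?_)
  rw [DoubleCentralizer.norm_fst]
  exact mul_le_mul_of_nonneg_left hGn (norm_nonneg _)

theorem bddMultiplier_injective : Function.Injective (bddMultiplier (X := X) (B := B)) := by
  intro a b h
  refine BoundedContinuousFunction.ext fun x => MultiplierAux.eq_of_forall_mul_right fun d => ?_
  obtain ⟨G, rfl, -⟩ := exists_apply_eq x d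
  rw [← bddMultiplier_apply, h, bddMultiplier_apply]

theorem norm_bddMultiplier (a : X →ᵇ B) : ‖bddMultiplier a‖ = ‖a‖ := by
  refine le_antisymm (norm_bddMultiplier_le a)
    ((BoundedContinuousFunction.norm_le (norm_nonneg _)).mpr fun x =>
      norm_le_of_forall_mul (norm_nonneg _) fun d => ?_)
  obtain ⟨G, hG, hGn⟩ := exists_apply_eq x d
  rw [← hG, ← bddMultiplier_apply, hG]
  refine (norm_apply_le _ _).trans (((bddMultiplier a).fst.le_opNorm G).trans ?_)
  rw [DoubleCentralizer.norm_fst]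
  exact mul_le_mul_of_nonneg_left hGn (norm_nonneg _)

variable (X B) in
/-- The `*`-homomorphism from `Cᵇ(X, B)` to `A^β`. -/
def betaBddHom : (X →ᵇ B) →⋆ₙₐ[ℂ] (trivialCZeroAlgebra X B).beta where
  toFun a := ⟨bddMultiplier a, bddMultiplier_mem_beta a⟩
  map_smul' c a := Subtype.ext (map_smul (bddMultiplierHom X B) c a)
  map_zero' := Subtype.ext (map_zero (bddMultiplierHom X B))
  map_add' a b := Subtype.ext (map_add (bddMultiplierHom X B) a b)
  map_mul' a b := Subtype.ext (map_mul (bddMultiplierHom X B) a b)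
  map_star' a := Subtype.ext (map_star (bddMultiplierHom X B) a)

theorem betaBddHom_bijective : Function.Bijective (betaBddHom X B) := by
  refine ⟨fun a b h => bddMultiplier_injective (congrArg Subtype.val h), fun m => ?_⟩
  obtain ⟨a, ha⟩ := exists_bddMultiplier_eq m.2
  exact ⟨a, Subtype.ext ha⟩

variable (X B) in
/-- The isomorphism of `Cᵇ(X, B)` with `A^β`. -/
def betaEquiv : (X →ᵇ B) ≃⋆ₐ[ℂ] (trivialCZeroAlgebra X B).beta :=
  StarAlgEquiv.ofBijective (betaBddHom X B) betaBddHom_bijective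

theorem coe_betaEquiv (a : X →ᵇ B) :
    (betaEquiv X B a : 𝓜(ℂ, C₀(X, B))) = bddMultiplier a := rfl

theorem norm_betaEquiv (a : X →ᵇ B) : ‖betaEquiv X B a‖ = ‖a‖ := norm_bddMultiplier a

theorem toBeta_eq (F : C₀(X, B)) :
    (trivialCZeroAlgebra X B).toBeta F = betaEquiv X B F.toBCF :=
  Subtype.ext (bddMultiplier_toBCF F).symm

/-! ### Fibres and sections of `A^β` over `βX`. -/

theorem betaAlgebra_μ_fst (u : C₀(StoneCech X, ℂ)) (a : X →ᵇ B) :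
    ((trivialCZeroAlgebra X B).betaAlgebra.μ u).fst (betaEquiv X B a) =
      betaEquiv X B (extSMul u a) :=
  Subtype.ext (μExt_mul_bddMultiplier u a)

theorem exists_betaEquiv_eq (m : (trivialCZeroAlgebra X B).beta) :
    ∃ a : X →ᵇ B, betaEquiv X B a = m := betaBddHom_bijective.surjective m

theorem betaEquiv_add (a b : X →ᵇ B) :
    betaEquiv X B (a + b) = betaEquiv X B a + betaEquiv X B b := map_add (betaBddHom X B) a b

theorem betaEquiv_sub (a b : X →ᵇ B) :
    betaEquiv X B (a - b) = betaEquiv X B a - betaEquiv X B b := map_sub (betaBddHom X B) a b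

theorem betaEquiv_smul (c : ℂ) (a : X →ᵇ B) :
    betaEquiv X B (c • a) = c • betaEquiv X B a := map_smul (betaBddHom X B) c a

/-- The seminorm `normExt · y` is norm-continuous and kills the generators, because it multiplies by
`‖u y‖` under the action of `u`. -/
theorem normExt_eq_zero_of_mem_J {y : StoneCech X} {a : X →ᵇ B}
    (ha : betaEquiv X B a ∈ (trivialCZeroAlgebra X B).betaAlgebra.J y) : normExt a y = 0 := by
  refine (trivialCZeroAlgebra X B).betaAlgebra.J_induction y
    (p := fun m => ∀ a, betaEquiv X B a = m → normExt a y = 0)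
    (isClosed_of_closure_subset fun m hm => ?_) ?_ ?_ ?_ ?_ ha a rfl
  · rintro a rfl
    refine le_antisymm (le_of_forall_pos_le_add fun ε hε => ?_) (normExt_nonneg _ _)
    obtain ⟨n, hn, hd⟩ := Metric.mem_closure_iff.mp hm ε hε
    obtain ⟨b, rfl⟩ := exists_betaEquiv_eq n
    rw [dist_eq_norm, ← betaEquiv_sub, norm_betaEquiv] at hd
    have h1 := normExt_add_le (a - b) b y
    rw [sub_add_cancel, hn b rfl] at h1
    linarith [normExt_le (a - b) y]
  · intro u m hu a ha
    obtain ⟨b, rfl⟩ := exists_betaEquiv_eq m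
    rw [betaAlgebra_μ_fst] at ha
    rw [betaBddHom_bijective.injective ha, normExt_extSMul, hu, norm_zero, zero_mul]
  · intro a ha
    rw [betaBddHom_bijective.injective (ha.trans (map_zero (betaBddHom X B)).symm),
      ← zero_smul ℂ (0 : X →ᵇ B), normExt_smul, norm_zero, zero_mul]
  · intro m n hm hn a ha
    obtain ⟨b, rfl⟩ := exists_betaEquiv_eq m
    obtain ⟨c, rfl⟩ := exists_betaEquiv_eq n
    rw [← betaEquiv_add] at ha
    rw [betaBddHom_bijective.injective ha]
    refine le_antisymm ?_ (normExt_nonneg _ _)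
    exact (normExt_add_le _ _ y).trans_eq (by rw [hm b rfl, hn c rfl, add_zero])
  · intro c m hm a ha
    obtain ⟨b, rfl⟩ := exists_betaEquiv_eq m
    rw [← betaEquiv_smul] at ha
    rw [betaBddHom_bijective.injective ha, normExt_smul, hm b rfl, mul_zero]

/-- For `b` in the ideal, `normExt a y ≤ normExt (a - b) y ≤ ‖a - b‖`; the cutoff on `βX` gives the
reverse bound. Continuity of `A^β` follows at once. -/
theorem norm_value_betaEquiv (a : X →ᵇ B) (y : StoneCech X) :
    ‖(trivialCZeroAlgebra X B).betaAlgebra.value (betaEquiv X B a) y‖ = normExt a y := by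
  refine (trivialCZeroAlgebra X B).betaAlgebra.norm_value_eq (fun j hj => ?_) fun ε hε => ?_
  · obtain ⟨b, rfl⟩ := exists_betaEquiv_eq j
    have h1 := normExt_add_le (a - b) b y
    rw [sub_add_cancel, normExt_eq_zero_of_mem_J hj, add_zero] at h1
    rw [← betaEquiv_sub, norm_betaEquiv]
    exact h1.trans (normExt_le _ y)
  · obtain ⟨u, hu, hn⟩ := exists_cutoff_ext a y hε
    refine ⟨u, hu, ?_⟩
    rwa [betaAlgebra_μ_fst, ← betaEquiv_sub, norm_betaEquiv]

variable (X B) in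
theorem isContinuous_betaAlgebra : (trivialCZeroAlgebra X B).betaAlgebra.IsContinuous := by
  intro m
  obtain ⟨a, rfl⟩ := exists_betaEquiv_eq m
  simp only [norm_value_betaEquiv]
  exact (normExt a).continuous

theorem value_betaEquiv_unit_eq_iff (a b : X →ᵇ B) (x : X) :
    (trivialCZeroAlgebra X B).betaAlgebra.value (betaEquiv X B a) (stoneCechUnit x) =
      (trivialCZeroAlgebra X B).betaAlgebra.value (betaEquiv X B b) (stoneCechUnit x) ↔
      a x = b x := by
  rw [← sub_eq_zero, ← CZeroAlgebra.value_sub, ← betaEquiv_sub, ← norm_eq_zero, norm_value_betaEquiv,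
    normExt_unit, norm_eq_zero, ← sub_eq_zero (a := a x)]
  rfl

variable (X B) in
/-- The inclusion of `A` in `A^β`, as a `*`-homomorphism. -/
def toBetaHom : C₀(X, B) →⋆ₙₐ[ℂ] (trivialCZeroAlgebra X B).beta where
  toFun F := (trivialCZeroAlgebra X B).toBeta F
  map_smul' c F := Subtype.ext (map_smul (DoubleCentralizer.coeHom (𝕜 := ℂ) (A := C₀(X, B))) c F)
  map_zero' := Subtype.ext (map_zero (DoubleCentralizer.coeHom (𝕜 := ℂ) (A := C₀(X, B))))
  map_add' F G := Subtype.ext (map_add (DoubleCentralizer.coeHom (𝕜 := ℂ) (A := C₀(X, B))) F G)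
  map_mul' F G := Subtype.ext (map_mul (DoubleCentralizer.coeHom (𝕜 := ℂ) (A := C₀(X, B))) F G)
  map_star' F := Subtype.ext (map_star (DoubleCentralizer.coeHom (𝕜 := ℂ) (A := C₀(X, B))) F)

variable (X B) in
-- `A` already fills the fibre of `A^β` at `x`: any bounded `a` agrees at `x` with some `F ∈ A`, and
-- the fibre norm there is `‖a x‖`.
theorem exists_betaFibreEquiv (x : X) :
    ∃ κ : B ≃⋆ₐ[ℂ] (trivialCZeroAlgebra X B).betaAlgebra.Fibre (stoneCechUnit x),
      ∀ F : C₀(X, B), κ (F x) = (trivialCZeroAlgebra X B).betaAlgebra.value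
        ((trivialCZeroAlgebra X B).toBeta F) (stoneCechUnit x) := by
  refine exists_starAlgEquiv_of_ker_eq (evalHom X B x)
    (((trivialCZeroAlgebra X B).betaAlgebra.valueHom (stoneCechUnit x)).comp (toBetaHom X B))
    (evalHom_surjective x) (fun z => ?_) fun F => ?_
  · obtain ⟨m, rfl⟩ := CZeroAlgebra.Fibre.mk_surjective _ _ z
    obtain ⟨a, rfl⟩ := exists_betaEquiv_eq m
    obtain ⟨F, hF, -⟩ := exists_apply_eq x (a x)
    refine ⟨F, ?_⟩
    change (trivialCZeroAlgebra X B).betaAlgebra.value ((trivialCZeroAlgebra X B).toBeta F) _ = _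
    rw [toBeta_eq]
    exact (value_betaEquiv_unit_eq_iff _ _ x).mpr hF
  · change F x = 0 ↔
      (trivialCZeroAlgebra X B).betaAlgebra.value ((trivialCZeroAlgebra X B).toBeta F) _ = 0
    rw [toBeta_eq, ← norm_eq_zero (a := CZeroAlgebra.value _ _ _), norm_value_betaEquiv,
      normExt_unit, norm_eq_zero]
    rfl

/-- The extension sends `y` to the value at `y` of `a` seen as an element of `A^β`. Uniqueness holds
because `A^β` is continuous and `X` is dense in `βX`. -/
theorem existsUnique_section (κ : ∀ x : X,
      B ≃⋆ₐ[ℂ] (trivialCZeroAlgebra X B).betaAlgebra.Fibre (stoneCechUnit x))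
    (hκ : ∀ (x : X) (F : C₀(X, B)), κ x (F x) = (trivialCZeroAlgebra X B).betaAlgebra.value
      ((trivialCZeroAlgebra X B).toBeta F) (stoneCechUnit x)) (a : X →ᵇ B) :
    ∃! s : ∀ y : StoneCech X, (trivialCZeroAlgebra X B).betaAlgebra.Fibre y,
      (trivialCZeroAlgebra X B).betaAlgebra.IsContinuousSection Set.univ (fun y => s y) ∧
      ∀ x : X, s (stoneCechUnit x) = κ x (a x) := by
  have hval : ∀ x, (trivialCZeroAlgebra X B).betaAlgebra.value (betaEquiv X B a) (stoneCechUnit x)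
      = κ x (a x) := by
    intro x
    obtain ⟨F, hF, -⟩ := exists_apply_eq x (a x)
    rw [← hF, hκ, toBeta_eq]
    exact (value_betaEquiv_unit_eq_iff _ _ x).mpr hF.symm
  refine ⟨fun y => (trivialCZeroAlgebra X B).betaAlgebra.value (betaEquiv X B a) y,
    ⟨CZeroAlgebra.isContinuousSection_value _ _ _, hval⟩, ?_⟩
  rintro s ⟨hs, hsκ⟩
  refine funext fun y => (isContinuous_betaAlgebra X B).section_eq
    (denseRange_stoneCechUnit (α := X)) hs ?_ y
  rintro _ ⟨x, rfl⟩
  rw [hsκ, hval]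

/-! ### Comparison with `C(βX, B)` -/

theorem exists_continuousMap_equiv_beta_iff : (∃ Ψ : C(StoneCech X, B) ≃⋆ₐ[ℂ] (trivialCZeroAlgebra X B).beta,
      ∀ (g : C(StoneCech X, B)) (F : C₀(X, B)) (x : X),
        (Ψ g : 𝓜(ℂ, C₀(X, B))).fst F x = g (stoneCechUnit x) * F x) ↔
    (FiniteDimensional ℂ B ∨ IsPseudocompact X) := by
  constructor
  · rintro ⟨Ψ, hΨ⟩
    by_contra h
    push Not at h
    obtain ⟨a, ha⟩ := exists_bounded_not_totallyBounded h.2 h.1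
    obtain ⟨g, hg⟩ := Ψ.surjective (betaEquiv X B a)
    -- The formula for `Ψ` forces `g` to extend `a`, so the range of `a` lies in the compact set
    -- `g(βX)`, a contradiction.
    have e : restrictHom X B g = a := bddMultiplier_injective <| by
      rw [← coe_betaEquiv a, ← hg]
      exact MultiplierAux.ext_fst fun F => by ext x; exact (hΨ g F x).symm
    refine ha ((isCompact_range g.continuous).totallyBounded.subset ?_)
    rintro _ ⟨x, rfl⟩
    exact ⟨stoneCechUnit x, DFunLike.congr_fun e x⟩
  · intro h
    have hb : Function.Bijective (restrictHom X B) := by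
      refine ⟨restrictHom_injective, fun a => ?_⟩
      obtain ⟨g, hg⟩ := BoundedContinuousFunction.exists_stoneCech_extension h a
      exact ⟨g, BoundedContinuousFunction.ext hg⟩
    exact ⟨(StarAlgEquiv.ofBijective (restrictHom X B) hb).trans (betaEquiv X B),
      fun g F x => rfl⟩

end TrivialCZeroAlgebra

end

theorem corollaryc (X : Type u) (B : Type v) [TopologicalSpace X] [T2Space X]
    [LocallyCompactSpace X] [NonUnitalCStarAlgebra B] :
    -- the fibres of `A` are canonically `B`, and `Γᵇ(A) = Cᵇ(X, B)`
    (∃ ι : ∀ x : X, B ≃⋆ₐ[ℂ] (trivialCZeroAlgebra X B).Fibre x,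
      (∀ (x : X) (F : C₀(X, B)), ι x (F x) = (trivialCZeroAlgebra X B).value F x) ∧
      ∃ Φ : (X →ᵇ B) ≃⋆ₐ[ℂ] (trivialCZeroAlgebra X B).boundedSections,
        (∀ (a : X →ᵇ B) (x : (trivialCZeroAlgebra X B).support),
          (Φ a : ∀ x : (trivialCZeroAlgebra X B).support,
            (trivialCZeroAlgebra X B).Fibre (x : X)) x = ι x (a x)) ∧
        ∀ a : X →ᵇ B, ⨆ x : (trivialCZeroAlgebra X B).support,
          ‖(Φ a : ∀ x : (trivialCZeroAlgebra X B).support,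
            (trivialCZeroAlgebra X B).Fibre (x : X)) x‖ = ‖a‖) ∧
    -- `A^β = Cᵇ(X, B)` inside `M(A)`
    (∃ Θ : (X →ᵇ B) ≃⋆ₐ[ℂ] (trivialCZeroAlgebra X B).beta,
      ∀ (a : X →ᵇ B) (F : C₀(X, B)) (x : X),
        (Θ a : 𝓜(ℂ, C₀(X, B))).fst F x = a x * F x) ∧
    -- `A^β` is a continuous `C(βX)`-algebra
    (trivialCZeroAlgebra X B).betaAlgebra.IsContinuous ∧
    -- the fibres of `A^β` at the points of `X` are canonically `B`, and
    -- bounded continuous functions extend uniquely to continuous sections over `βX`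
    (∃ κ : ∀ x : X, B ≃⋆ₐ[ℂ] (trivialCZeroAlgebra X B).betaAlgebra.Fibre (stoneCechUnit x),
      (∀ (x : X) (F : C₀(X, B)), κ x (F x) =
        (trivialCZeroAlgebra X B).betaAlgebra.value ((trivialCZeroAlgebra X B).toBeta F)
          (stoneCechUnit x)) ∧
      ∀ a : X →ᵇ B, ∃! s : ∀ y : StoneCech X, (trivialCZeroAlgebra X B).betaAlgebra.Fibre y,
        (trivialCZeroAlgebra X B).betaAlgebra.IsContinuousSection Set.univ (fun y => s y) ∧
        ∀ x : X, s (stoneCechUnit x) = κ x (a x)) ∧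
    -- the canonical map `C(βX, B) → A^β` is an isomorphism exactly in the two cases
    ((∃ Ψ : C(StoneCech X, B) ≃⋆ₐ[ℂ] (trivialCZeroAlgebra X B).beta,
        ∀ (g : C(StoneCech X, B)) (F : C₀(X, B)) (x : X),
          (Ψ g : 𝓜(ℂ, C₀(X, B))).fst F x = g (stoneCechUnit x) * F x) ↔
      (FiniteDimensional ℂ B ∨ IsPseudocompact X)) := by
  refine ⟨⟨fun x => TrivialCZeroAlgebra.fibreEquiv X B x,
    fun x F => TrivialCZeroAlgebra.fibreEquiv_apply x F,
    StarAlgEquiv.ofBijective (TrivialCZeroAlgebra.sectionHom X B)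
      TrivialCZeroAlgebra.sectionHom_bijective,
    fun a x => TrivialCZeroAlgebra.sectionHom_apply a x,
    fun a => TrivialCZeroAlgebra.iSup_norm_sectionHom a⟩,
    ⟨TrivialCZeroAlgebra.betaEquiv X B,
      fun a F x => TrivialCZeroAlgebra.bddMultiplier_apply a F x⟩,
    TrivialCZeroAlgebra.isContinuous_betaAlgebra X B, ?_, TrivialCZeroAlgebra.exists_continuousMap_equiv_beta_iff⟩
  choose κ hκ using TrivialCZeroAlgebra.exists_betaFibreEquiv X B
  exact ⟨κ, hκ, fun a => TrivialCZeroAlgebra.existsUnique_section κ hκ a⟩
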